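/- Conventions. A continuum is a nonempty compact connected metric space. A finite graph is a topological space homeomorphic to the geometric realization of a (combinatorial) finite graph. For a finite graph $G$, a continuum $X$ is $G$-like if for every $\varepsilon>0$ there is a continuous surjection $g:X\to G$ all of whose fibres $g^{-1}(p)$, $p\in G$, have diameter less than $\varepsilon$. Let $f:X\to X$. A collection $\mathcal A$ of subsets of $X$ has an independence set of positive density (i.s.p.d.) for $f$ if there is $I\subseteq\mathbb N$ such that $\lim_{n\to\infty}|I\cap[1,n]|/n$ exists and is positive and such that for every finite $J\subseteq I$ and all choices $Y_j\in\mathcal A$ $(j\in J)$ one has $\bigcap_{j\in J}f^{-j}(Y_j)\ne\emptyset$. A pair $(x,y)\in X^2$ is an IE-pair if $\{A,B\}$ has an i.s.p.d. for all open $A\ni x$, $B\ni y$. The nerve of a finite collection $\mathcal G$ of sets is the graph with vertex set $\mathcal G$ in which two distinct members are joined by an edge when they intersect; the nerve "is $G$" if its geometric realization as a graph is homeomorphic to $G$. An $\varepsilon$-cover of $X$ is a finite cover by open sets of diameter less than $\varepsilon$. Distinct members $C_1,\dots,C_n$ of $\mathcal G$ form a chain if $C_i\cap C_{i+1}\neq\emptyset$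 for $1\le i<n$, and $\overline{C_i}\cap\overline{C_j}\ne\emptyset$ implies $|i-j|\le1$; the chain is free in $\mathcal G$ if moreover, for $1<i<n$, every $C\in\mathcal G$ with $\overline C\cap\overline{C_i}\neq\emptyset$ is one of $C_{i-1},C_i,C_{i+1}$. For $l$ odd and $U,V\subseteq X$, the chain is an $l$-zigzag from $U$ to $V$ if there are $1=k_1<k_2<\dots<k_{l+1}=n$ such that $C_{k_i}\cap U\ne\emptyset$ for $i$ odd, $C_{k_i}\cap V\neq\emptyset$ for $i$ even, and the collection $\{C_{k_i}\cap U: i\text{ odd}\}\cup\{C_{k_i}\cap V: i\text{ even}\}$ $(1\le i\le l+1)$ has an i.s.p.d. for $f$. A pair $(x,y)$ is a Z-pair for $f$ if for all open $U\ni x$, $V\ni y$, every $\varepsilon>0$ and every odd $l\in\mathbb N$, there are an $\varepsilon$-cover $\mathcal G$ of $X$ whose nerve is $G$ and a free chain $C_1,\dots,C_n$ in $\mathcal G$ with $x\in C_1$, $y\in C_n$ which is an $l$-zigzag from $U$ to $V$. Theorem. Let $G$ be a finite graph, $X$ a $G$-like continuum and $h:X\to X$ a homeomorphism. (1) If $A_0,A_1\subseteq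 X$ are disjoint closed sets such that $\{A_0,A_1\}$ has an i.s.p.d. for $h$, then there are $x\in A_0$ and $y\in A_1$ such that $(x,y)$ is a Z-pair for $h$. (2) If $(x,y)$ is an IE-pair for $h$ with $x\ne y$, then for every $\varepsilon>0$ there is a Z-pair $(x',y')$ for $h$ with $d(x,x')<\varepsilon$ and $d(y,y')<\varepsilon$. -/

import Mathlib

open Filter Topology

namespace ZigzagPair

/-- The geometric realization of a finite simple graph `Γ`, in barycentric coordinates: the union in
`V → ℝ` of the vertices and of the segments joining adjacent vertices. -/
def realization {V : Type*} [Fintype V] (Γ : SimpleGraph V) : Set (V → ℝ) :=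
  {p | (∀ v, 0 ≤ p v) ∧ ∑ v, p v = 1 ∧
    ∃ u v, (u = v ∨ Γ.Adj u v) ∧ ∀ w, p w ≠ 0 → w = u ∨ w = v}

/-- `G` is (topologically) a finite graph. Loops and multiple edges are covered, since they can be
subdivided without changing the topological space. -/
def IsFiniteGraph (G : Type*) [TopologicalSpace G] : Prop :=
  ∃ (m : ℕ) (Γ : SimpleGraph (Fin m)), Nonempty (G ≃ₜ realization Γ)

/-- `g` is a continuous map from `X` onto `G` all of whose fibres have diameter less than `ε`. -/
def IsEpsMap {X G : Type*} [MetricSpace X] [TopologicalSpace G] (ε : ℝ) (g : X → G) : Prop :=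
  Continuous g ∧ Function.Surjective g ∧ ∀ p : G, Metric.diam (g ⁻¹' {p}) < ε

/-- The (compact) metric space `X` is `G`-like. -/
def IsLike (X G : Type*) [MetricSpace X] [TopologicalSpace G] : Prop :=
  ∀ ε : ℝ, 0 < ε → ∃ g : X → G, IsEpsMap ε g

/-- A set of natural numbers has positive density: its density exists and is positive. -/
def HasPosDensity (I : Set ℕ) : Prop :=
  ∃ d : ℝ, 0 < d ∧
    Tendsto (fun n : ℕ => ((I ∩ Set.Icc 1 n).ncard : ℝ) / (n : ℝ)) atTop (𝓝 d)

/-- The collection `𝒜` has an independence set with positive density (i.s.p.d.) for `f`. -/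
def HasISPD {X : Type*} (f : X → X) (𝒜 : Set (Set X)) : Prop :=
  ∃ I : Set ℕ, HasPosDensity I ∧
    ∀ J : Finset ℕ, (J : Set ℕ) ⊆ I →
      ∀ Y : ℕ → Set X, (∀ j ∈ J, Y j ∈ 𝒜) → (⋂ j ∈ J, f^[j] ⁻¹' (Y j)).Nonempty

/-- `(x, y)` is an IE-pair for `f`. -/
def IsIEPair {X : Type*} [TopologicalSpace X] (f : X → X) (x y : X) : Prop :=
  ∀ A B : Set X, IsOpen A → IsOpen B → x ∈ A → y ∈ B → HasISPD f {A, B}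

/-- The nerve of a finite collection of sets, as a graph: the vertices are the members of the
collection, and distinct members are adjacent when they intersect. -/
def nerve {X : Type*} (𝒢 : Finset (Set X)) : SimpleGraph 𝒢 where
  Adj a b := a ≠ b ∧ ((a : Set X) ∩ (b : Set X)).Nonempty
  symm := ⟨fun _ _ h => ⟨h.1.symm, by rw [Set.inter_comm]; exact h.2⟩⟩
  loopless := ⟨fun _ h => h.1 rfl⟩

/-- `𝒢` is a finite cover of `X` by open sets of diameter less than `ε`. -/
def IsEpsCover {X : Type*} [MetricSpace X] (ε : ℝ) (𝒢 : Finset (Set X)) : Prop :=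
  (∀ S ∈ 𝒢, IsOpen S ∧ Metric.diam S < ε) ∧ ∀ x : X, ∃ S ∈ 𝒢, x ∈ S

/-- The nerve of `𝒢` is `G`: its geometric realization is homeomorphic to `G`. -/
def NerveIs {X : Type*} (G : Type*) [TopologicalSpace G] (𝒢 : Finset (Set X)) : Prop :=
  Nonempty (realization (nerve 𝒢) ≃ₜ G)

/-- `C 1, …, C n` are distinct members of `𝒢` that form a chain. -/
def IsChainIn {X : Type*} [TopologicalSpace X] (𝒢 : Finset (Set X)) (n : ℕ) (C : ℕ → Set X) :
    Prop :=
  1 ≤ n ∧ (∀ i ∈ Set.Icc 1 n, C i ∈ 𝒢) ∧ Set.InjOn C (Set.Icc 1 n) ∧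
    (∀ i, 1 ≤ i → i < n → (C i ∩ C (i + 1)).Nonempty) ∧
    ∀ i ∈ Set.Icc 1 n, ∀ j ∈ Set.Icc 1 n,
      (closure (C i) ∩ closure (C j)).Nonempty → i ≤ j + 1 ∧ j ≤ i + 1

/-- `C 1, …, C n` is a free chain in `𝒢`: a chain such that the closure of no interior link meets the
closure of a member of `𝒢` other than the link itself and its two neighbours in the chain. -/
def IsFreeChainIn {X : Type*} [TopologicalSpace X] (𝒢 : Finset (Set X)) (n : ℕ)
    (C : ℕ → Set X) : Prop :=
  IsChainIn 𝒢 n C ∧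
    ∀ i, 1 < i → i < n → ∀ S ∈ 𝒢, (closure S ∩ closure (C i)).Nonempty →
      S = C (i - 1) ∨ S = C i ∨ S = C (i + 1)

/-- The chain `C 1, …, C n` is an `l`-zigzag from `U` to `V` (with respect to `f`). -/
def IsZigzag {X : Type*} (f : X → X) (l n : ℕ) (C : ℕ → Set X) (U V : Set X) : Prop :=
  ∃ k : ℕ → ℕ, k 1 = 1 ∧ k (l + 1) = n ∧ StrictMonoOn k (Set.Icc 1 (l + 1)) ∧
    (∀ i ∈ Set.Icc 1 (l + 1), Odd i → (C (k i) ∩ U).Nonempty) ∧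
    (∀ i ∈ Set.Icc 1 (l + 1), Even i → (C (k i) ∩ V).Nonempty) ∧
    HasISPD f
      ({S | ∃ i ∈ Set.Icc 1 (l + 1), Odd i ∧ S = C (k i) ∩ U} ∪
        {S | ∃ i ∈ Set.Icc 1 (l + 1), Even i ∧ S = C (k i) ∩ V})

/-- `(x, y)` is a Z-pair for the self-map `f` of the `G`-like continuum `X`. -/
def IsZPair {X : Type*} [MetricSpace X] (G : Type*) [TopologicalSpace G] (f : X → X)
    (x y : X) : Prop :=
  ∀ U V : Set X, IsOpen U → IsOpen V → x ∈ U → y ∈ V →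
    ∀ ε : ℝ, 0 < ε → ∀ l : ℕ, Odd l →
      ∃ 𝒢 : Finset (Set X), IsEpsCover ε 𝒢 ∧ NerveIs G 𝒢 ∧
        ∃ (n : ℕ) (C : ℕ → Set X), IsFreeChainIn 𝒢 n C ∧ x ∈ C 1 ∧ y ∈ C n ∧
          IsZigzag f l n C U V

end ZigzagPair

/-! Replace i.s.p.d. by the weaker condition `HasPosIndep`: infinitely many initial segments of the
times contain an independence set of proportion at least some fixed positive constant. This survives
pigeonholing over finitely many cases, and Fekete's lemma together with an ultrafilter limit turns
it back into i.s.p.d. (`exists_hasPosDensity`, `HasPosIndep.hasISPD`). A Karpovsky–Milman count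
shows that every member of such a family may be shrunk into a member of a given finite cover
(`HasPosIndep.exists_refine`).

The core is `exists_zigzag`. Let A₀, A₁ be disjoint, closed and independent in this sense. For
suitable times j₁ < … < j_m, the 2^m sets A_σ of points whose iterates at these times follow a
binary word σ again form an independent family (`HasPosIndep.exists_words`). Take a map g onto the
graph so fine that points with nearby images stay close under every h^{jᵢ}, subdivide the edges, and
shrink each A_σ into one cell. Distinct words get distinct cells, since their points are separated
at some time jᵢ. As 2^m grows faster than linearly in m, one edge carries so many of these cells
that, listed in order along the edge, some coordinate i of their words alternates l + 1 times
(`exists_alternating_coordinate`).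

Applying h^{jᵢ} carries these cells alternately into A₀ and A₁, while g ∘ h^{-jᵢ} is still a fine
map onto the graph; here invertibility of h enters. The pulled-back stars along the edge form a free
chain that zigzags, and the nerve of the whole cover of stars is the subdivided graph, hence has
realization G. The sets at the two ends of the zigzag are closed, disjoint and again independent, so
the construction can be repeated with smaller ε and larger l; the nested ends shrink to a Z-pair
(`exists_isZPair`). The second statement applies the first to two small disjoint closed balls. -/

namespace ZigzagPair

/-! ### Independence along sets of times of positive proportion. -/

section Independence

variable {X α : Type*}

/-- The finite set `J` of times is an independence set for the family `A`. -/
def IsIndepSet (f : X → X) (A : α → Set X) (J : Finset ℕ) : Prop :=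
  ∀ ω : ℕ → α, ∃ x, ∀ j ∈ J, f^[j] x ∈ A (ω j)

/-- Arbitrarily long initial segments of `ℕ` contain independence sets for `A` of proportion bounded
below. -/
def HasPosIndep (f : X → X) (A : α → Set X) : Prop :=
  ∃ c : ℝ, 0 < c ∧ ∃ᶠ n : ℕ in atTop,
    ∃ J ⊆ Finset.Icc 1 n, c * n ≤ J.card ∧ IsIndepSet f A J

theorem IsIndepSet.shift {f : X → X} {A : α → Set X} {J K : Finset ℕ} {s : ℕ}
    (hJ : IsIndepSet f A J) (hK : ∀ k ∈ K, k + s ∈ J) : IsIndepSet f A K := by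
  intro ω
  obtain ⟨x, hx⟩ := hJ fun j => ω (j - s)
  refine ⟨f^[s] x, fun k hk => ?_⟩
  have := hx _ (hK k hk)
  rwa [Function.iterate_add_apply, Nat.add_sub_cancel] at this

/-- If x realizes the relabelled word in A, then f^[k] x realizes the original word in B, because
iterates commute. Thus letters may be renamed and sets moved forward by a fixed time without
changing the set of times. -/
theorem HasPosIndep.map {β : Type*} {f : X → X} {A : α → Set X} {B : β → Set X}
    (hA : HasPosIndep f A) (e : β → α) (k : ℕ) (h : ∀ b, ∀ x ∈ A (e b), f^[k] x ∈ B b) :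
    HasPosIndep f B := by
  obtain ⟨c, hc, hf⟩ := hA
  refine ⟨c, hc, hf.mono ?_⟩
  rintro n ⟨J, hJ, hcard, hind⟩
  refine ⟨J, hJ, hcard, fun ω => ?_⟩
  obtain ⟨x, hx⟩ := hind (e ∘ ω)
  refine ⟨f^[k] x, fun j hj => ?_⟩
  rw [← Function.iterate_add_apply, add_comm, Function.iterate_add_apply]
  exact h _ _ (hx j hj)

theorem HasPosIndep.mono {f : X → X} {A B : α → Set X}
    (hA : HasPosIndep f A) (h : ∀ a, A a ⊆ B a) : HasPosIndep f B :=
  hA.map id 0 h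

theorem HasPosIndep.nonempty {f : X → X} {A : α → Set X} (hA : HasPosIndep f A) (a : α) :
    (A a).Nonempty := by
  obtain ⟨c, hc, hf⟩ := hA
  obtain ⟨n, ⟨J, hJ, hcard, hind⟩, hn⟩ := (hf.and_eventually (eventually_ge_atTop 1)).exists
  have : 0 < J.card := by
    have : (0 : ℝ) < J.card := lt_of_lt_of_le (by positivity) hcard
    exact_mod_cast this
  obtain ⟨j, hj⟩ := Finset.card_pos.1 this
  obtain ⟨x, hx⟩ := hind fun _ => a
  exact ⟨_, hx j hj⟩

theorem exists_frequently_of_finite {β : Type*} {κ : Type*} [Finite κ] {l : Filter β}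
    {P : β → κ → Prop} (h : ∃ᶠ b in l, ∃ k, P b k) : ∃ k, ∃ᶠ b in l, P b k := by
  by_contra! hc
  refine h ?_
  have : ∀ k, ∀ᶠ b in l, ¬ P b k := fun k => by simpa [Filter.Frequently] using hc k
  filter_upwards [eventually_all.2 this] with b hb
  rintro ⟨k, hk⟩
  exact hb k hk

theorem HasISPD.hasPosIndep {f : X → X} {𝒜 : Set (Set X)} {A : α → Set X} (h : HasISPD f 𝒜)
    (hA : ∀ a, A a ∈ 𝒜) : HasPosIndep f A := by
  classical
  obtain ⟨I, ⟨d, hd, hlim⟩, hI⟩ := h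
  refine ⟨d / 2, by positivity, Eventually.frequently ?_⟩
  filter_upwards [hlim.eventually (lt_mem_nhds (half_lt_self hd)), eventually_ge_atTop 1]
    with n hn hn1
  have hn0 : (0 : ℝ) < n := by exact_mod_cast hn1
  refine ⟨(Finset.Icc 1 n).filter (· ∈ I), Finset.filter_subset _ _, ?_, fun ω => ?_⟩
  · rw [lt_div_iff₀ hn0] at hn
    have e : I ∩ Set.Icc 1 n = ((Finset.Icc 1 n).filter (· ∈ I) : Finset ℕ) := by
      ext k; simp; tauto
    rw [e, Set.ncard_coe_finset] at hn
    exact hn.le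
  · obtain ⟨x, hx⟩ := hI ((Finset.Icc 1 n).filter (· ∈ I)) (fun k hk => by simp_all)
      (fun j => A (ω j)) (fun j _ => hA _)
    exact ⟨x, by simpa using hx⟩

end Independence

/-! ### From positive proportion to positive density. -/

section Density

variable {P : Finset ℕ → Prop}

/-- The largest cardinality of a subset of `{1, …, n}` satisfying `P`. -/
noncomputable def maxCard (P : Finset ℕ → Prop) (n : ℕ) : ℕ :=
  open Classical in ((Finset.Icc 1 n).powerset.filter P).sup Finset.card

theorem card_le_maxCard {n : ℕ} {J : Finset ℕ} (hJ : J ⊆ Finset.Icc 1 n) (h : P J) :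
    J.card ≤ maxCard P n := by
  classical
  unfold maxCard
  exact Finset.le_sup (f := Finset.card) (by simp [hJ, h])

theorem exists_card_eq_maxCard (h0 : P ∅) (n : ℕ) :
    ∃ J ⊆ Finset.Icc 1 n, P J ∧ J.card = maxCard P n := by
  classical
  have hne : ((Finset.Icc 1 n).powerset.filter P).Nonempty := ⟨∅, by simp [h0]⟩
  obtain ⟨J, hJ, e⟩ := Finset.exists_mem_eq_sup _ hne Finset.card
  simp only [Finset.mem_filter, Finset.mem_powerset] at hJ
  refine ⟨J, hJ.1, hJ.2, ?_⟩
  unfold maxCard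
  convert e.symm

/-- Cut an optimal set at m and translate the upper part down by m; both pieces inherit P. This is
the subadditivity needed for Fekete's lemma. -/
theorem maxCard_add_le (h0 : P ∅) (hP : ∀ J K s, (∀ k ∈ K, k + s ∈ J) → P J → P K) (m n : ℕ) :
    maxCard P (m + n) ≤ maxCard P m + maxCard P n := by
  classical
  obtain ⟨J, hJ, hPJ, e⟩ := exists_card_eq_maxCard h0 (m + n)
  rw [← e]
  have h1 : (J.filter (· ≤ m)).card ≤ maxCard P m := by
    refine card_le_maxCard (fun k hk => ?_) (hP J _ 0 (fun k hk => ?_) hPJ)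
    · have := hJ (Finset.mem_filter.1 hk).1
      simp_all
    · simp_all
  have h2 : (J.filter (¬ · ≤ m)).card ≤ maxCard P n := by
    have hc : ((J.filter (¬ · ≤ m)).image (· - m)).card = (J.filter (¬ · ≤ m)).card := by
      refine Finset.card_image_of_injOn fun a ha b hb hab => ?_
      simp only [Finset.coe_filter, Set.mem_ofPred_eq] at ha hb hab
      omega
    rw [← hc]
    refine card_le_maxCard (fun k hk => ?_) (hP J _ m (fun k hk => ?_) hPJ)
    · obtain ⟨a, ha, rfl⟩ := Finset.mem_image.1 hk
      have := Finset.mem_Icc.1 (hJ (Finset.mem_filter.1 ha).1)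
      have := (Finset.mem_filter.1 ha).2
      simp only [Finset.mem_Icc]
      omega
    · obtain ⟨a, ha, rfl⟩ := Finset.mem_image.1 hk
      have := (Finset.mem_filter.1 ha).2
      rw [Nat.sub_add_cancel (by omega)]
      exact (Finset.mem_filter.1 ha).1
  rw [← Finset.card_filter_add_card_filter_not (s := J) (fun k => k ≤ m)]
  omega

/-- A finite set of proportion at least `d` in a long initial segment has a translate all of whose
initial segments of length at most `M` have proportion nearly `d`. -/
theorem exists_shift_of_le_card {J : Finset ℕ} {N M : ℕ} {d ε : ℝ} (hd : 0 ≤ d)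
    (hJ : J ⊆ Finset.Icc 1 N) (hcard : d * N ≤ J.card) (hN : d * M < ε * N) :
    ∃ s, ∀ m ≤ M, (d - ε) * m ≤ (J ∩ Finset.Ioc s (s + m)).card := by
  by_contra! hc
  -- If no translate works, every t starts a sparse interval of length at most M. Jumping along
  -- these intervals reaches past N with overshoot at most M, which makes J too small.
  have key : ∀ t, ∃ s, t ≤ s ∧ s ≤ t + M ∧ ((J ∩ Finset.Ioc 0 s).card : ℝ) ≤ (d - ε) * s := by
    intro t
    induction t with
    | zero => exact ⟨0, by simp⟩
    | succ t ih =>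
      obtain ⟨s, h1, h2, h3⟩ := ih
      rcases h1.lt_or_eq with h | rfl
      · exact ⟨s, h, by omega, h3⟩
      · obtain ⟨m, hm, hlt⟩ := hc t
        have hm0 : m ≠ 0 := by
          rintro rfl
          simp at hlt
        refine ⟨t + m, by omega, by omega, ?_⟩
        have e : J ∩ Finset.Ioc 0 (t + m)
            = (J ∩ Finset.Ioc 0 t) ∪ (J ∩ Finset.Ioc t (t + m)) := by
          ext k
          simp only [Finset.mem_inter, Finset.mem_Ioc, Finset.mem_union]
          grind
        have := Finset.card_union_le (J ∩ Finset.Ioc 0 t) (J ∩ Finset.Ioc t (t + m))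
        rw [← e] at this
        have : ((J ∩ Finset.Ioc 0 (t + m)).card : ℝ)
            ≤ (J ∩ Finset.Ioc 0 t).card + (J ∩ Finset.Ioc t (t + m)).card := by
          exact_mod_cast this
        push_cast
        linarith
  obtain ⟨s, h1, h2, h3⟩ := key N
  have e : J ∩ Finset.Ioc 0 s = J := by
    refine Finset.inter_eq_left.2 fun k hk => ?_
    have := Finset.mem_Icc.1 (hJ hk)
    simp only [Finset.mem_Ioc]
    omega
  rw [e] at h3
  have h1' : (N : ℝ) ≤ s := by exact_mod_cast h1
  have h2' : (s : ℝ) ≤ N + M := by exact_mod_cast h2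
  have hε : 0 ≤ ε := by
    by_contra! hneg
    have h5 : ε * N ≤ 0 := mul_nonpos_of_nonpos_of_nonneg hneg.le (by positivity)
    have h6 : 0 ≤ d * M := by positivity
    linarith
  have h5 : d * (s - N) ≤ d * M := mul_le_mul_of_nonneg_left (by linarith) hd
  have h6 : 0 ≤ ε * (s - N) := mul_nonneg hε (by linarith)
  nlinarith

/-- A translation invariant hereditary property of finite sets of natural numbers that holds for sets
of positive proportion holds for all finite subsets of a set of positive density. -/
theorem exists_hasPosDensity (hP : ∀ J K s, (∀ k ∈ K, k + s ∈ J) → P J → P K) {c : ℝ} (hc : 0 < c)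
    (hfreq : ∃ᶠ n : ℕ in atTop, ∃ J ⊆ Finset.Icc 1 n, c * n ≤ J.card ∧ P J) :
    ∃ I : Set ℕ, HasPosDensity I ∧ ∀ J : Finset ℕ, (J : Set ℕ) ⊆ I → P J := by
  classical
  have h0 : P ∅ := by
    obtain ⟨n, J, -, -, hJ⟩ := hfreq.exists
    exact hP J ∅ 0 (by simp) hJ
  have hsub : Subadditive fun n => (maxCard P n : ℝ) := fun m n => by
    simpa using (Nat.cast_le (α := ℝ)).2 (maxCard_add_le h0 hP m n)
  have hbdd : BddBelow (Set.range fun n : ℕ => (maxCard P n : ℝ) / n) :=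
    ⟨0, by rintro _ ⟨n, rfl⟩; positivity⟩
  set d := hsub.lim with hd_def
  have hlim := hsub.tendsto_lim hbdd
  -- Otherwise the optimal proportions would eventually fall below c.
  have hd : 0 < d := by
    refine lt_of_lt_of_le hc (le_of_not_gt fun hlt => ?_)
    refine hfreq ?_
    filter_upwards [hlim.eventually (gt_mem_nhds hlt), eventually_ge_atTop 1] with n hn hn1
    rintro ⟨J, hJ, hcard, hPJ⟩
    have hn0 : (0 : ℝ) < n := by exact_mod_cast hn1
    rw [div_lt_iff₀ hn0] at hn
    have : (J.card : ℝ) ≤ maxCard P n := by exact_mod_cast card_le_maxCard hJ hPJ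
    linarith
  -- Near-optimal windows: the Fekete limit d is a lower bound for the optimal proportion at every
  -- N, so a long optimal set has a translate that is dense on all initial segments up to M.
  have hwin : ∀ M : ℕ, ∃ K : Finset ℕ, P K ∧
      ∀ m ≤ M, (d - 1 / (M + 1)) * m ≤ (K ∩ Finset.Icc 1 m).card := by
    intro M
    obtain ⟨N, hN⟩ := exists_nat_gt (max 1 (d * M * (M + 1)))
    have hN0 : N ≠ 0 := by
      rintro rfl
      have := (le_max_left _ _).trans_lt hN
      norm_num at this
    obtain ⟨J, hJ, hPJ, e⟩ := exists_card_eq_maxCard h0 N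
    have hle := hsub.lim_le_div hbdd hN0
    have hN' : (0 : ℝ) < N := by positivity
    rw [le_div_iff₀ hN', ← hd_def] at hle
    obtain ⟨s, hs⟩ := exists_shift_of_le_card (ε := 1 / (M + 1)) hd.le hJ (by rw [e]; exact hle)
      (M := M) (by
        rw [one_div, inv_mul_eq_div, lt_div_iff₀ (by positivity)]
        exact (le_max_right _ _).trans_lt hN)
    refine ⟨(J.filter (s < ·)).image (· - s), hP J _ s (fun k hk => ?_) hPJ, fun m hm => ?_⟩
    · obtain ⟨a, ha, rfl⟩ := Finset.mem_image.1 hk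
      rw [Nat.sub_add_cancel (by simp at ha; omega)]
      exact (Finset.mem_filter.1 ha).1
    · refine (hs m hm).trans ?_
      have : (J ∩ Finset.Ioc s (s + m)).card
          ≤ ((J.filter (s < ·)).image (· - s) ∩ Finset.Icc 1 m).card := by
        refine Finset.card_le_card_of_injOn (· - s) (fun k hk => ?_) (fun a ha b hb hab => ?_)
        · simp only [Finset.coe_inter, Set.mem_inter_iff, Finset.mem_coe, Finset.mem_Ioc] at hk
          simp only [Finset.coe_inter, Set.mem_inter_iff, Finset.mem_coe, Finset.mem_image,
            Finset.mem_filter, Finset.mem_Icc]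
          exact ⟨⟨k, ⟨hk.1, hk.2.1⟩, rfl⟩, by omega, by omega⟩
        · simp only [Finset.coe_inter, Set.mem_inter_iff, Finset.mem_coe, Finset.mem_Ioc] at ha hb
          simp only at hab
          omega
      exact_mod_cast this
  choose K hPK hK using hwin
  let 𝒰 : Ultrafilter ℕ := hyperfilter ℕ
  have h𝒰 : (𝒰 : Filter ℕ) ≤ atTop := Nat.hyperfilter_le_atTop
  -- The ultrafilter limit of the windows. A finite subset of I lies in a single window, so P holds
  -- for it; the windows bound the density of I below by d, and `maxCard` bounds it above by d.
  let I : Set ℕ := {k | ∀ᶠ M in (𝒰 : Filter ℕ), k ∈ K M}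
  have hI : ∀ J : Finset ℕ, (J : Set ℕ) ⊆ I → P J := by
    intro J hJ
    have : ∀ᶠ M in (𝒰 : Filter ℕ), ∀ k ∈ J, k ∈ K M :=
      (eventually_all_finset J).2 fun k hk => hJ hk
    obtain ⟨M, hM⟩ := this.exists
    exact hP (K M) J 0 hM (hPK M)
  have hIcc : ∀ m : ℕ, I ∩ Set.Icc 1 m = ((Finset.Icc 1 m).filter (· ∈ I) : Finset ℕ) := by
    intro m; ext k; simp; tauto
  have hlow : ∀ m : ℕ, d * m ≤ ((I ∩ Set.Icc 1 m).ncard : ℝ) := by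
    intro m
    have hev : ∀ᶠ M in (𝒰 : Filter ℕ), K M ∩ Finset.Icc 1 m = (Finset.Icc 1 m).filter (· ∈ I) := by
      have : ∀ᶠ M in (𝒰 : Filter ℕ), ∀ k ∈ Finset.Icc 1 m, (k ∈ K M ↔ k ∈ I) := by
        refine (eventually_all_finset _).2 fun k _ => ?_
        by_cases hk : k ∈ I
        · filter_upwards [show ∀ᶠ M in (𝒰 : Filter ℕ), k ∈ K M from hk] with M hM
          simp [hM, hk]
        · filter_upwards [Ultrafilter.eventually_not.2 (show ¬ ∀ᶠ M in (𝒰 : Filter ℕ), k ∈ K M from hk)]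
            with M hM
          simp [hM, hk]
      filter_upwards [this] with M hM
      ext k
      simp only [Finset.mem_inter, Finset.mem_filter]
      exact ⟨fun h => ⟨h.2, (hM k h.2).1 h.1⟩, fun h => ⟨(hM k h.1).2 h.2, h.1⟩⟩
    rw [hIcc, Set.ncard_coe_finset]
    have ht : Tendsto (fun M : ℕ => (d - 1 / ((M : ℝ) + 1)) * m) (𝒰 : Filter ℕ) (𝓝 (d * m)) := by
      have := (tendsto_one_div_add_atTop_nhds_zero_nat (𝕜 := ℝ)).mono_left h𝒰
      simpa using (this.const_sub d).mul_const (m : ℝ)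
    refine le_of_tendsto ht ?_
    filter_upwards [hev, h𝒰 (eventually_ge_atTop m)] with M hM hmM
    rw [← hM]
    exact hK M m hmM
  refine ⟨I, ⟨d, hd, ?_⟩, hI⟩
  refine tendsto_of_tendsto_of_tendsto_of_le_of_le' tendsto_const_nhds hlim ?_ ?_
  · filter_upwards [eventually_ge_atTop 1] with n hn
    have hn0 : (0 : ℝ) < n := by exact_mod_cast hn
    rw [le_div_iff₀ hn0]
    exact hlow n
  · refine Eventually.of_forall fun n => ?_
    gcongr
    rw [hIcc, Set.ncard_coe_finset]
    exact card_le_maxCard (Finset.filter_subset _ _) (hI _ fun k hk => by simp_all)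

end Density

theorem HasPosIndep.hasISPD {X α : Type*} [Nonempty X] {f : X → X} {A : α → Set X} (hA : HasPosIndep f A)
    {𝒜 : Set (Set X)} (h : ∀ S ∈ 𝒜, ∃ a, A a ⊆ S) : HasISPD f 𝒜 := by
  classical
  obtain ⟨c, hc, hf⟩ := hA
  obtain ⟨I, hI, hJ⟩ := exists_hasPosDensity (P := IsIndepSet f A)
    (fun J K s hK hJ => hJ.shift hK) hc hf
  refine ⟨I, hI, fun J hJI Y hY => ?_⟩
  rcases J.eq_empty_or_nonempty with rfl | ⟨j₀, hj₀⟩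
  · exact ⟨Classical.arbitrary X, by simp⟩
  obtain ⟨a₀, -⟩ := h _ (hY j₀ hj₀)
  have : ∀ j, ∃ a, j ∈ J → A a ⊆ Y j := fun j => by
    by_cases hj : j ∈ J
    · obtain ⟨a, ha⟩ := h _ (hY j hj)
      exact ⟨a, fun _ => ha⟩
    · exact ⟨a₀, fun h => absurd h hj⟩
  choose ω hω using this
  obtain ⟨x, hx⟩ := hJ J hJI ω
  exact ⟨x, by simpa using fun j hj => hω j hj (hx j hj)⟩

/-! ### Large sets of words shatter many coordinates. -/

section Shatter

variable {ι α : Type*}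

/-- Every word on `W` is the restriction of a member of `S`. -/
def ShattersWords (S : Finset (ι → α)) (W : Finset ι) : Prop :=
  ∀ y : ι → α, ∃ s ∈ S, ∀ i ∈ W, s i = y i

open Classical in
/-- A weighted form of the Karpovsky–Milman theorem. -/
theorem card_le_sum_shattersWords [Fintype α] {q : ℕ} (hα : Fintype.card α = q + 1) (a₀ : α)
    (J : Finset ι) : ∀ S : Finset (ι → α), (∀ s ∈ S, ∀ i ∉ J, s i = a₀) →
      S.card ≤ ∑ W ∈ J.powerset, if ShattersWords S W then q ^ (J.card - W.card) else 0 := by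
  induction J using Finset.induction_on with
  | empty =>
    intro S hS
    have h1 : S.card ≤ 1 := Finset.card_le_one.2 fun a ha b hb => by
      ext i; rw [hS a ha i (by simp), hS b hb i (by simp)]
    rcases S.eq_empty_or_nonempty with rfl | ⟨s, hs⟩
    · simp
    · have : ShattersWords S ∅ := fun y => ⟨s, hs, by simp⟩
      rw [Finset.powerset_empty, Finset.sum_singleton, if_pos this]
      simpa using h1
  | insert j J hj ih =>
    intro S hS
    -- Forget the coordinate j: U consists of the shortened words, and I of those that extend by
    -- every letter. A shortened word outside I has at most q extensions.
    let ν : (ι → α) → (ι → α) := fun s => Function.update s j a₀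
    let U : Finset (ι → α) := S.image ν
    let I : Finset (ι → α) := U.filter fun u => ∀ a, Function.update u j a ∈ S
    have hU : ∀ u ∈ U, ∀ i ∉ J, u i = a₀ := by
      intro u hu i hi
      obtain ⟨s, hs, rfl⟩ := Finset.mem_image.1 hu
      by_cases hij : i = j
      · subst hij; simp [ν]
      · simp only [ν, Function.update_of_ne hij]
        exact hS s hs i (by simp [hij, hi])
    have hfib : ∀ u ∈ U, (S.filter fun s => ν s = u).card ≤ q + if u ∈ I then 1 else 0 := by
      intro u hu
      let T : Finset α := Finset.univ.filter fun a => Function.update u j a ∈ S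
      have hle : (S.filter fun s => ν s = u).card ≤ T.card := by
        refine Finset.card_le_card_of_injOn (fun s => s j) (fun s hs => ?_) (fun s hs t ht hst => ?_)
        · obtain ⟨hs, rfl⟩ := Finset.mem_filter.1 hs
          simpa [T, ν] using hs
        · have hs' := (Finset.mem_filter.1 hs).2
          have ht' := (Finset.mem_filter.1 ht).2
          have e : ∀ s : ι → α, s = Function.update (ν s) j (s j) := fun s => by simp [ν]
          rw [e s, e t, hs', ht']
          simp only at hst
          rw [hst]
      refine hle.trans ?_
      by_cases hI : u ∈ I
      · rw [if_pos hI, ← hα]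
        exact Finset.card_le_univ _
      · rw [if_neg hI, add_zero]
        have hne : T ≠ Finset.univ := by
          intro h
          refine hI (Finset.mem_filter.2 ⟨hu, fun a => ?_⟩)
          have := Finset.mem_univ a
          rw [← h] at this
          exact (Finset.mem_filter.1 this).2
        have := (Finset.card_lt_iff_ne_univ T).2 hne
        omega
    have hcard : S.card ≤ q * U.card + I.card := by
      rw [Finset.card_eq_sum_card_image ν S]
      refine (Finset.sum_le_sum hfib).trans ?_
      rw [Finset.sum_add_distrib, Finset.sum_const, smul_eq_mul, mul_comm, ← Finset.card_filter]
      gcongr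
      intro u hu
      exact (Finset.mem_filter.1 hu).2
    have hIU : I ⊆ U := Finset.filter_subset _ _
    have h1 := ih U hU
    have h2 := ih I fun u hu => hU u (hIU hu)
    rw [Finset.sum_powerset_insert hj]
    -- Sets W without j are accounted for by U, with the extra factor q; sets containing j by I,
    -- since W shattered by I gives `insert j W` shattered by S.
    refine hcard.trans (add_le_add ((Nat.mul_le_mul_left q h1).trans ?_) (h2.trans ?_))
    · rw [Finset.mul_sum]
      refine Finset.sum_le_sum fun W hW => ?_
      have hWJ := Finset.mem_powerset.1 hW
      by_cases hsh : ShattersWords U W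
      · have : ShattersWords S W := by
          intro y
          obtain ⟨u, hu, huy⟩ := hsh y
          obtain ⟨s, hs, rfl⟩ := Finset.mem_image.1 hu
          refine ⟨s, hs, fun i hi => ?_⟩
          rw [← huy i hi]
          have : i ≠ j := fun h => hj (h ▸ hWJ hi)
          simp [ν, this]
        rw [if_pos hsh, if_pos this, Finset.card_insert_of_notMem hj, ← pow_succ']
        have := Finset.card_le_card hWJ
        rw [show J.card + 1 - W.card = J.card - W.card + 1 by omega]
      · simp [hsh]
    · refine Finset.sum_le_sum fun W hW => ?_
      have hWJ := Finset.mem_powerset.1 hW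
      by_cases hsh : ShattersWords I W
      · have : ShattersWords S (insert j W) := by
          intro y
          obtain ⟨u, hu, huy⟩ := hsh y
          refine ⟨_, (Finset.mem_filter.1 hu).2 (y j), fun i hi => ?_⟩
          rcases Finset.mem_insert.1 hi with rfl | hi
          · simp
          · have : i ≠ j := fun h => hj (h ▸ hWJ hi)
            rw [Function.update_of_ne this, huy i hi]
        rw [if_pos hsh, if_pos this, Finset.card_insert_of_notMem hj,
          Finset.card_insert_of_notMem fun h => hj (hWJ h), Nat.add_sub_add_right]
      · simp [hsh]

/-- A set of words that is exponentially larger than the number of words avoiding a letter shatters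
a set of coordinates of positive proportion. -/
theorem exists_shattersWords [Fintype α] {q : ℕ} (hα : Fintype.card α = q + 1) {x : ℝ}
    (hx : 0 < x) (hx1 : x ≤ 1) :
    ∃ r : ℕ, 0 < r ∧ ∀ {κ : Type} [Fintype κ] (S : Finset (κ → α)),
      (q + 2 * x) ^ Fintype.card κ ≤ S.card →
        ∃ W : Finset κ, Fintype.card κ ≤ r * W.card ∧ ShattersWords S W := by
  classical
  -- The exponent r is chosen so that ρ ^ r * x > 1; it depends only on q and x, not on the number
  -- of coordinates.
  set ρ : ℝ := (q + 2 * x) / (q + x) with hρ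
  have hq : (0 : ℝ) < q + x := by positivity
  have hρ1 : 1 < ρ := by
    rw [hρ, one_lt_div hq]
    linarith
  obtain ⟨r, hr⟩ := pow_unbounded_of_one_lt (1 / x) hρ1
  have hr0 : 0 < r := by
    rcases Nat.eq_zero_or_pos r with rfl | h
    · rw [pow_zero, div_lt_one hx] at hr
      linarith
    · exact h
  rw [div_lt_iff₀ hx] at hr
  refine ⟨r, hr0, fun {κ} _ S hS => ?_⟩
  set n := Fintype.card κ
  by_contra! hc
  have ⟨a₀⟩ : Nonempty α := Fintype.card_pos_iff.1 (by omega)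
  have hle := card_le_sum_shattersWords hα a₀ Finset.univ S (by simp)
  have hSne : S.Nonempty := Finset.card_pos.1 <| by
    have : (0 : ℝ) < S.card := lt_of_lt_of_le (by positivity) hS
    exact_mod_cast this
  have hn : 0 < n := by
    by_contra! hn
    obtain ⟨s, hs⟩ := hSne
    exact hc ∅ (by omega) fun y => ⟨s, hs, by simp⟩
  have hW : ∀ W : Finset κ, ShattersWords S W → W.card ≤ n / r := by
    intro W hsh
    by_contra! hlt
    refine hc W ?_ hsh
    have := Nat.lt_mul_of_div_lt hlt hr0
    rw [mul_comm]
    exact this.le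
  -- Weight the count by x ^ |W|: as x ≤ 1 and shattered sets have at most n / r elements, the
  -- binomial sum (q + x) ^ n dominates.
  have h1 : (S.card : ℝ) * x ^ (n / r) ≤ (q + x) ^ n := by
    have h2 : (S.card : ℝ) ≤ ∑ W ∈ (Finset.univ : Finset κ).powerset,
        if ShattersWords S W then (q : ℝ) ^ (n - W.card) else 0 := by
      have := (Nat.cast_le (α := ℝ)).2 hle
      push_cast at this
      simpa [Finset.card_univ] using this
    have h3 := Finset.sum_pow_mul_eq_add_pow x (q : ℝ) (Finset.univ : Finset κ)
    rw [Finset.card_univ, add_comm] at h3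
    rw [← h3]
    refine (mul_le_mul_of_nonneg_right h2 (by positivity)).trans ?_
    rw [Finset.sum_mul]
    refine Finset.sum_le_sum fun W _ => ?_
    split_ifs with hsh
    · rw [mul_comm]
      exact mul_le_mul_of_nonneg_right (pow_le_pow_of_le_one hx.le hx1 (hW W hsh)) (by positivity)
    · rw [zero_mul]; positivity
  have h4 : 1 < ρ ^ n * x ^ (n / r) := by
    rcases Nat.eq_zero_or_pos (n / r) with h | h
    · rw [h, pow_zero, mul_one]
      exact one_lt_pow₀ hρ1 hn.ne'
    · calc (1 : ℝ) < (ρ ^ r * x) ^ (n / r) := one_lt_pow₀ hr h.ne'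
        _ = ρ ^ (r * (n / r)) * x ^ (n / r) := by rw [mul_pow, pow_mul]
        _ ≤ ρ ^ n * x ^ (n / r) := by
          gcongr
          · exact hρ1.le
          · exact Nat.mul_div_le n r
  have h5 : (q + 2 * x) ^ n * x ^ (n / r) ≤ (q + x) ^ n :=
    (mul_le_mul_of_nonneg_right hS (by positivity)).trans h1
  rw [hρ, div_pow, div_mul_eq_mul_div, one_lt_div (by positivity)] at h4
  linarith

end Shatter

/-! ### Shrinking an independent family into a finite cover. -/

section Refinement

variable {X α P : Type*}

/-- If each word `ω` is provided with marks on its letters `a`, then for some prescription of marks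
there are many words with the prescribed marks. -/
theorem exists_marks [Fintype α] [DecidableEq α] [Fintype P] [Nonempty P] {q : ℕ}
    (hα : Fintype.card α = q + 1) {κ : Type} [Fintype κ] [DecidableEq κ] (a : α)
    (s : (κ → α) → κ → P) :
    ∃ R : κ → P, ∃ S : Finset (κ → α), (∀ ω ∈ S, ∀ i, ω i = a → s ω i = R i) ∧
      ((q : ℝ) + 1 / Fintype.card P) ^ Fintype.card κ ≤ S.card := by
  classical
  let T : (κ → P) → Finset (κ → α) := fun R =>
    Finset.univ.filter fun ω => ∀ i, ω i = a → s ω i = R i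
  suffices h : ∃ R, ((q : ℝ) + 1 / Fintype.card P) ^ Fintype.card κ ≤ (T R).card by
    obtain ⟨R, hR⟩ := h
    exact ⟨R, T R, fun ω hω => (Finset.mem_filter.1 hω).2, hR⟩
  -- Double counting: a word leaves the prescription free exactly at the letters other than a, so
  -- the sum over words factors as a product over coordinates. Averaging over all prescriptions
  -- gives the bound.
  have hcount : ∑ R : κ → P, (T R).card = (1 + q * Fintype.card P) ^ Fintype.card κ := by
    have h1 : ∑ R : κ → P, (T R).card = ∑ ω : κ → α,
        (Finset.univ.filter fun R : κ → P => ∀ i, ω i = a → s ω i = R i).card := by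
      simp only [T, Finset.card_filter]
      exact Finset.sum_comm
    have h2 : ∀ ω : κ → α,
        (Finset.univ.filter fun R : κ → P => ∀ i, ω i = a → s ω i = R i).card
          = ∏ i, if ω i = a then 1 else Fintype.card P := by
      intro ω
      have : (Finset.univ.filter fun R : κ → P => ∀ i, ω i = a → s ω i = R i)
          = Fintype.piFinset fun i => if ω i = a then {s ω i} else Finset.univ := by
        ext R
        simp only [Finset.mem_filter, Finset.mem_univ, true_and, Fintype.mem_piFinset]
        refine forall_congr' fun i => ?_
        split_ifs with h <;> simp [h, eq_comm]
      rw [this, Fintype.card_piFinset]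
      refine Finset.prod_congr rfl fun i _ => ?_
      split_ifs <;> simp
    rw [h1, Finset.sum_congr rfl fun ω _ => h2 ω]
    have h3 := Finset.prod_univ_sum (fun _ : κ => (Finset.univ : Finset α))
      (fun _ b => if b = a then 1 else Fintype.card P)
    rw [Fintype.piFinset_univ] at h3
    rw [← h3, Finset.prod_const, Finset.card_univ]
    congr 1
    rw [Finset.sum_ite, Finset.sum_const, Finset.sum_const, Finset.filter_eq' Finset.univ a,
      Finset.filter_ne' Finset.univ a]
    simp [hα]
  have hp : (0 : ℝ) < Fintype.card P := by exact_mod_cast Fintype.card_pos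
  obtain ⟨R, -, hR⟩ := Finset.exists_le_of_sum_le (s := (Finset.univ : Finset (κ → P)))
    (f := fun _ => ((q : ℝ) + 1 / Fintype.card P) ^ Fintype.card κ)
    (g := fun R => ((T R).card : ℝ)) Finset.univ_nonempty (by
      rw [← Nat.cast_sum, hcount, Finset.sum_const, Finset.card_univ, Fintype.card_fun,
        nsmul_eq_mul]
      push_cast
      rw [← mul_pow]
      refine le_of_eq ?_
      congr 1
      field_simp
      ring)
  exact ⟨R, hR⟩

-- Pick a point realizing each word and mark each occurrence of a by a cover member containing the
-- corresponding iterate. Many words obey one prescription R of marks; they shatter a positive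
-- proportion of the times, and R is constant on a positive proportion of those.
open Classical in
theorem HasPosIndep.exists_refine_one [Fintype α] [Fintype P] [Nonempty P] {f : X → X}
    {A : α → Set X} (hA : HasPosIndep f A) (D : P → Set X) (hD : ∀ x, ∃ c, x ∈ D c) (a : α) :
    ∃ c, HasPosIndep f fun b => if b = a then A b ∩ D c else A b := by
  obtain ⟨q, hq⟩ : ∃ q, Fintype.card α = q + 1 :=
    ⟨_, (Nat.succ_pred_eq_of_pos (Fintype.card_pos_iff.2 ⟨a⟩)).symm⟩
  have hp : (1 : ℝ) ≤ Fintype.card P := by exact_mod_cast Fintype.card_pos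
  obtain ⟨r, hr, hsh⟩ := exists_shattersWords hq (x := 1 / (2 * Fintype.card P)) (by positivity)
    (by rw [div_le_one (by positivity)]; linarith)
  obtain ⟨c₀, hc₀, hf⟩ := hA
  have hp0 : (0 : ℝ) < Fintype.card P := by linarith
  have hr' : (0 : ℝ) < r := by exact_mod_cast hr
  have key : ∃ᶠ n : ℕ in atTop, ∃ c, ∃ J ⊆ Finset.Icc 1 n,
      c₀ / (r * Fintype.card P) * n ≤ J.card ∧
        IsIndepSet f (fun b => if b = a then A b ∩ D c else A b) J := by
    refine hf.mono ?_
    rintro n ⟨J, hJ, hcard, hind⟩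
    have hx : ∀ ω : J → α, ∃ x, ∀ j : J, f^[j] x ∈ A (ω j) := by
      intro ω
      obtain ⟨x, hx⟩ := hind fun j => if hj : j ∈ J then ω ⟨j, hj⟩ else a
      exact ⟨x, fun j => by simpa using hx j j.2⟩
    choose x hx using hx
    choose d hd using hD
    obtain ⟨R, S, hS, hScard⟩ := exists_marks hq a fun (ω : J → α) (j : J) => d (f^[j] (x ω))
    obtain ⟨W, hW, hWS⟩ := hsh S (by
      refine le_trans (le_of_eq ?_) hScard
      congr 2
      field_simp)
    obtain ⟨c, -, hc⟩ := Finset.exists_le_of_sum_le (s := (Finset.univ : Finset P))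
      (f := fun _ => (W.card : ℝ) / Fintype.card P)
      (g := fun c => ((W.filter fun j => R j = c).card : ℝ)) Finset.univ_nonempty (by
        rw [Finset.sum_const, Finset.card_univ, nsmul_eq_mul, mul_div_cancel₀ _ hp0.ne',
          ← Nat.cast_sum,
          ← Finset.card_eq_sum_card_fiberwise (f := R) (t := Finset.univ) (by simp)])
    refine ⟨c, (W.filter fun j => R j = c).map (Function.Embedding.subtype _), ?_, ?_, ?_⟩
    · intro j hj
      obtain ⟨i, -, rfl⟩ := Finset.mem_map.1 hj
      exact hJ i.2
    · rw [Finset.card_map]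
      refine le_trans ?_ hc
      rw [Fintype.card_coe] at hW
      have hW' : (J.card : ℝ) ≤ r * W.card := by exact_mod_cast hW
      rw [div_mul_eq_mul_div, div_le_div_iff₀ (by positivity) hp0]
      nlinarith
    · intro y
      obtain ⟨ω, hω, hy⟩ := hWS fun j => y j
      refine ⟨x ω, fun j hj => ?_⟩
      obtain ⟨i, hi, rfl⟩ := Finset.mem_map.1 hj
      obtain ⟨hiW, hiR⟩ := Finset.mem_filter.1 hi
      have h1 := hx ω i
      rw [hy i hiW] at h1
      rw [Function.Embedding.subtype_apply]
      by_cases h : y i = a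
      · simp only [if_pos h]
        refine ⟨h1, ?_⟩
        have := hS ω hω i (by rw [hy i hiW, h])
        rw [← hiR, ← this]
        exact hd _
      · simpa only [if_neg h] using h1
  -- The cover member c so far depends on n; finiteness of P fixes one that works infinitely often.
  obtain ⟨c, hc⟩ := exists_frequently_of_finite key
  exact ⟨c, _, by positivity, hc⟩

/-- The members of a family with independence sets of positive proportion can be replaced by
their intersections with suitable members of a finite cover. -/
theorem HasPosIndep.exists_refine [Fintype α] [Fintype P] [Nonempty P] {f : X → X}
    {A : α → Set X} (hA : HasPosIndep f A) (D : P → Set X) (hD : ∀ x, ∃ c, x ∈ D c) :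
    ∃ κ : α → P, HasPosIndep f fun a => A a ∩ D (κ a) := by
  classical
  suffices h : ∀ T : Finset α, ∃ κ : α → P,
      HasPosIndep f fun a => if a ∈ T then A a ∩ D (κ a) else A a by
    simpa using h Finset.univ
  intro T
  induction T using Finset.induction_on with
  | empty => exact ⟨fun _ => Classical.arbitrary P, by simpa using hA⟩
  | insert a T ha ih =>
    obtain ⟨κ, hκ⟩ := ih
    obtain ⟨c, hc⟩ := hκ.exists_refine_one D hD a
    refine ⟨Function.update κ a c, hc.mono fun b => ?_⟩
    by_cases hb : b = a
    · subst hb; simp [ha]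
    · simp [hb]

end Refinement

/-! ### Passing from letters to words. -/

section Blocks

variable {X α : Type*}

open Classical in
/-- The pattern of `J` in the `k`-th block of length `w`. -/
noncomputable def blockPattern (J : Finset ℕ) (w k : ℕ) : Finset ℕ :=
  (Finset.range w).filter fun i => k * w + 1 + i ∈ J

theorem card_eq_sum_blockPattern {J : Finset ℕ} {n w : ℕ} (hw : 0 < w) (hJ : J ⊆ Finset.Icc 1 n) :
    J.card = ∑ k ∈ Finset.range (n / w + 1), (blockPattern J w k).card := by
  classical
  rw [Finset.card_eq_sum_card_fiberwise (f := fun j => (j - 1) / w)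
    (t := Finset.range (n / w + 1))]
  · refine Finset.sum_congr rfl fun k _ => ?_
    refine Finset.card_bij (fun j _ => (j - 1) % w) (fun j hj => ?_) (fun a ha b hb hab => ?_)
      (fun i hi => ?_)
    · obtain ⟨hjJ, rfl⟩ := Finset.mem_filter.1 hj
      have := Finset.mem_Icc.1 (hJ hjJ)
      have h := Nat.div_add_mod (j - 1) w
      rw [mul_comm] at h
      simp only [blockPattern, Finset.mem_filter, Finset.mem_range]
      refine ⟨Nat.mod_lt _ hw, ?_⟩
      convert hjJ using 1
      omega
    · obtain ⟨ha, hak⟩ := Finset.mem_filter.1 ha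
      obtain ⟨hb, hbk⟩ := Finset.mem_filter.1 hb
      have := Finset.mem_Icc.1 (hJ ha)
      have := Finset.mem_Icc.1 (hJ hb)
      have h1 := Nat.div_add_mod (a - 1) w
      have h2 := Nat.div_add_mod (b - 1) w
      rw [hak, hab] at h1
      rw [hbk] at h2
      omega
    · simp only [blockPattern, Finset.mem_filter, Finset.mem_range] at hi
      have e : k * w + 1 + i - 1 = i + w * k := by rw [mul_comm]; omega
      refine ⟨k * w + 1 + i, Finset.mem_filter.2 ⟨hi.2, ?_⟩, ?_⟩
      · rw [e, Nat.add_mul_div_left _ _ hw, Nat.div_eq_of_lt hi.1, zero_add]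
      · rw [e, Nat.add_mul_mod_self_left, Nat.mod_eq_of_lt hi.1]
  · intro j hj
    have := Finset.mem_Icc.1 (hJ hj)
    have : (j - 1) / w ≤ n / w := Nat.div_le_div_right (by omega)
    simp only [Finset.coe_range, Set.mem_Iio]
    omega

/-- If all patterns of size at least m were rare, these at most 2 ^ w patterns would contribute at
most c * n / 4 elements. The blocks with smaller patterns contribute at most m * (n / w + 1) ≤ c * n
/ 2, so J would have fewer than c * n elements. -/
theorem exists_frequent_blockPattern {J : Finset ℕ} {n w m : ℕ} {c : ℝ} (hc : 0 < c)
    (hJ : J ⊆ Finset.Icc 1 n) (hcard : c * n ≤ J.card) (hw0 : 0 < w) (hw : 4 * m ≤ c * w)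
    (hn : 4 * m ≤ c * n) (hn0 : 0 < n) :
    ∃ Q ∈ (Finset.range w).powerset, m ≤ Q.card ∧ c / (4 * w * 2 ^ w) * n ≤
      ((Finset.range (n / w + 1)).filter fun k => blockPattern J w k = Q).card := by
  classical
  by_contra! hcon
  set N : Finset ℕ → ℝ := fun Q =>
    ((Finset.range (n / w + 1)).filter fun k => blockPattern J w k = Q).card with hN
  have hmaps : ∀ k ∈ Finset.range (n / w + 1), blockPattern J w k ∈ (Finset.range w).powerset :=
    fun k _ => Finset.mem_powerset.2 (Finset.filter_subset _ _)
  have hsum : (J.card : ℝ) = ∑ Q ∈ (Finset.range w).powerset, Q.card * N Q := by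
    rw [card_eq_sum_blockPattern hw0 hJ, ← Finset.sum_fiberwise_of_maps_to hmaps]
    push_cast
    refine Finset.sum_congr rfl fun Q _ => ?_
    rw [Finset.sum_congr rfl (g := fun _ => (Q.card : ℝ))
      (fun k hk => by rw [(Finset.mem_filter.1 hk).2]), Finset.sum_const, nsmul_eq_mul, mul_comm]
  have hNsum : ∑ Q ∈ (Finset.range w).powerset, N Q = (n / w : ℕ) + 1 := by
    have := Finset.card_eq_sum_card_fiberwise hmaps
    rw [Finset.card_range] at this
    simp only [hN]
    exact_mod_cast this.symm
  have hw' : (0 : ℝ) < w := by exact_mod_cast hw0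
  have hn' : (0 : ℝ) < n := by exact_mod_cast hn0
  have hbound : ∀ Q ∈ (Finset.range w).powerset,
      (Q.card : ℝ) * N Q ≤ m * N Q + c / (4 * 2 ^ w) * n := by
    intro Q hQ
    have hN0 : 0 ≤ N Q := by positivity
    rcases le_total m Q.card with h | h
    · have h1 := (hcon Q hQ h).le
      have h2 : (Q.card : ℝ) ≤ w := by
        have := Finset.card_le_card (Finset.mem_powerset.1 hQ)
        rw [Finset.card_range] at this
        exact_mod_cast this
      have h3 : w * (c / (4 * w * 2 ^ w) * n) = c / (4 * 2 ^ w) * n := by field_simp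
      have h4 : (Q.card : ℝ) * N Q ≤ w * (c / (4 * w * 2 ^ w) * n) :=
        mul_le_mul h2 h1 hN0 hw'.le
      have : 0 ≤ m * N Q := by positivity
      linarith
    · have h1 : (Q.card : ℝ) ≤ m := by exact_mod_cast h
      have : 0 ≤ c / (4 * 2 ^ w) * n := by positivity
      nlinarith
  have htot : (J.card : ℝ) ≤ m * ((n / w : ℕ) + 1) + c / 4 * n := by
    rw [hsum]
    refine (Finset.sum_le_sum hbound).trans (le_of_eq ?_)
    rw [Finset.sum_add_distrib, ← Finset.mul_sum, hNsum, Finset.sum_const, Finset.card_powerset,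
      Finset.card_range, nsmul_eq_mul]
    push_cast
    field_simp
  have h5 : ((n / w : ℕ) : ℝ) ≤ n / w := Nat.cast_div_le
  have h6 : (m : ℝ) * (n / w : ℕ) ≤ c / 4 * n := by
    calc (m : ℝ) * (n / w : ℕ) ≤ m * (n / w) := by gcongr
      _ = m / w * n := by ring
      _ ≤ c / 4 * n := by
        refine mul_le_mul_of_nonneg_right ?_ hn'.le
        rw [div_le_iff₀ hw']
        linarith
  nlinarith [mul_pos hc hn']

/-- Words of length `m` in the members of the family are realized along suitable times in such a way
that the resulting sets again have independence sets of positive proportion. -/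
theorem HasPosIndep.exists_words {f : X → X} {A : α → Set X} (hA : HasPosIndep f A) {m : ℕ}
    (hm : 0 < m) : ∃ j : Fin m → ℕ,
      HasPosIndep f fun σ : Fin m → α => {x | ∀ i, f^[j i] x ∈ A (σ i)} := by
  classical
  obtain ⟨c, hc, hf⟩ := hA
  obtain ⟨w, hw⟩ := exists_nat_gt (4 * m / c)
  have hm' : (0 : ℝ) < m := by exact_mod_cast hm
  have hw' : (0 : ℝ) < w := lt_trans (by positivity) hw
  have hw0 : 0 < w := by exact_mod_cast hw'
  have hwc : 4 * m ≤ c * w := by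
    rw [div_lt_iff₀ hc] at hw
    linarith
  have key : ∃ᶠ n : ℕ in atTop, ∃ Q : (Finset.range w).powerset, m ≤ Q.1.card ∧
      ∃ J ⊆ Finset.Icc 1 n, IsIndepSet f A J ∧ c / (4 * w * 2 ^ w) * n ≤
        ((Finset.range (n / w + 1)).filter fun k => blockPattern J w k = Q).card := by
    refine (hf.and_eventually (eventually_ge_atTop w)).mono ?_
    rintro n ⟨⟨J, hJ, hcard, hind⟩, hn⟩
    have hn' : (w : ℝ) ≤ n := by exact_mod_cast hn
    obtain ⟨Q, hQ, hmQ, h⟩ := exists_frequent_blockPattern hc hJ hcard hw0 hwc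
      (hwc.trans (mul_le_mul_of_nonneg_left hn' hc.le)) (by omega)
    exact ⟨⟨Q, hQ⟩, hmQ, J, hJ, hind, h⟩
  obtain ⟨⟨Q, hQw⟩, hQ⟩ := exists_frequently_of_finite key
  obtain ⟨-, hmQ, -⟩ := hQ.exists
  dsimp only at hmQ
  let j : Fin m ↪o ℕ := Q.orderEmbOfCardLe hmQ
  have hj : ∀ i, j i ∈ Q := Q.orderEmbOfCardLe_mem hmQ
  have hjw : ∀ i, j i < w := fun i => Finset.mem_range.1 (Finset.mem_powerset.1 hQw (hj i))
  refine ⟨j, c / (4 * w * 2 ^ w), by positivity, hQ.mono ?_⟩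
  rintro n ⟨-, J, hJ, hind, hcard⟩
  have hinj : Function.Injective fun k => k * w + 1 := fun a b hab => by
    simpa [hw0.ne'] using hab
  have hmem : ∀ k, blockPattern J w k = Q → ∀ i, k * w + 1 + j i ∈ J := by
    intro k hk i
    have := hj i
    rw [← hk] at this
    exact (Finset.mem_filter.1 this).2
  refine ⟨((Finset.range (n / w + 1)).filter fun k => blockPattern J w k = Q).image
    fun k => k * w + 1, ?_, ?_, fun ω => ?_⟩
  · intro t ht
    obtain ⟨k, hk, rfl⟩ := Finset.mem_image.1 ht
    have := Finset.mem_Icc.1 (hJ (hmem k (Finset.mem_filter.1 hk).2 ⟨0, hm⟩))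
    simp only [Finset.mem_Icc]
    omega
  · rw [Finset.card_image_of_injective _ hinj]
    exact hcard
  -- Spread the words assigned to the block starts k * w + 1 over the times in the blocks;
  -- `Function.extend` recovers the index i from the offset, and its default letter index is
  -- irrelevant.
  · have hy : ∃ y : ℕ → α, ∀ k i, y (k * w + 1 + j i) = ω (k * w + 1) i := by
      refine ⟨fun t => ω ((t - 1) / w * w + 1) (Function.extend j id (fun _ => ⟨0, hm⟩) ((t - 1) % w)),
        fun k i => ?_⟩
      have e : k * w + 1 + j i - 1 = j i + w * k := by rw [mul_comm]; omega
      simp only [e, Nat.add_mul_div_left _ _ hw0, Nat.div_eq_of_lt (hjw i), zero_add,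
        Nat.add_mul_mod_self_left, Nat.mod_eq_of_lt (hjw i), j.injective.extend_apply, id]
    obtain ⟨y, hy⟩ := hy
    obtain ⟨x, hx⟩ := hind y
    refine ⟨x, fun t ht i => ?_⟩
    obtain ⟨k, hk, rfl⟩ := Finset.mem_image.1 ht
    have := hx _ (hmem k (Finset.mem_filter.1 hk).2 i)
    rw [hy, add_comm (k * w + 1), Function.iterate_add_apply] at this
    exact this

end Blocks

/-! ### Alternation in sequences of binary words. -/

section Alternation

/-- The number of terms less than `t` of the greedy alternating subsequence, beginning with `false`,
of the sequence `b` along `T`. -/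
def alternations (T : Finset ℕ) (b : ℕ → Bool) : ℕ → ℕ
  | 0 => 0
  | t + 1 => if t ∈ T ∧ b t = decide (Odd (alternations T b t)) then alternations T b t + 1
      else alternations T b t

theorem alternations_mono (T : Finset ℕ) (b : ℕ → Bool) : Monotone (alternations T b) := by
  refine monotone_nat_of_le_succ fun t => ?_
  simp only [alternations]
  split_ifs <;> omega

theorem exists_alternating (T : Finset ℕ) (b : ℕ → Bool) (t : ℕ) :
    ∃ p : ℕ → ℕ, StrictMonoOn p (Set.Icc 1 (alternations T b t)) ∧
      ∀ i ∈ Set.Icc 1 (alternations T b t), p i ∈ T ∧ p i < t ∧ b (p i) = decide (Even i) := by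
  induction t with
  | zero => exact ⟨id, strictMono_id.strictMonoOn _, by simp [alternations]⟩
  | succ t ih =>
    obtain ⟨p, hp, h⟩ := ih
    set r := alternations T b t with hr
    by_cases hc : t ∈ T ∧ b t = decide (Odd r)
    · have e : alternations T b (t + 1) = r + 1 := by
        simp only [alternations]
        rw [← hr, if_pos hc]
      rw [e]
      refine ⟨fun i => if i = r + 1 then t else p i, fun x hx y hy hxy => ?_, fun i hi => ?_⟩
      · simp only [Set.mem_Icc] at hx hy
        have hxr : x ≠ r + 1 := by omega
        simp only [if_neg hxr]
        split_ifs with hyr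
        · exact (h x ⟨hx.1, by omega⟩).2.1
        · exact hp ⟨hx.1, by omega⟩ ⟨hy.1, by omega⟩ hxy
      · simp only [Set.mem_Icc] at hi
        dsimp only
        split_ifs with hir
        · refine ⟨hc.1, by omega, ?_⟩
          rw [hc.2, hir]
          simp [Nat.even_add_one]
        · obtain ⟨h1, h2, h3⟩ := h i ⟨hi.1, by omega⟩
          exact ⟨h1, by omega, h3⟩
    · have e : alternations T b (t + 1) = r := by
        simp only [alternations]
        rw [← hr, if_neg hc]
      rw [e]
      exact ⟨p, hp, fun i hi => ⟨(h i hi).1, (h i hi).2.1.trans (by omega), (h i hi).2.2⟩⟩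

/-- In a long sequence of distinct words some coordinate alternates many times. -/
theorem exists_alternating_coordinate {m l : ℕ} (T : Finset ℕ) (w : ℕ → Fin m → Bool)
    (hw : Set.InjOn w T) (hT : m * l + 1 < T.card) :
    ∃ i : Fin m, ∃ p : ℕ → ℕ, StrictMonoOn p (Set.Icc 1 (l + 1)) ∧
      ∀ k ∈ Set.Icc 1 (l + 1), p k ∈ T ∧ w (p k) i = decide (Even k) := by
  obtain ⟨t₀, ht₀⟩ : ∃ t₀, ∀ t ∈ T, t < t₀ :=
    ⟨T.sup id + 1, fun t ht => Nat.lt_succ_of_le (Finset.le_sup (f := id) ht)⟩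
  let r : Fin m → ℕ → ℕ := fun i => alternations T fun t => w t i
  by_cases hex : ∃ i, l + 1 ≤ r i t₀
  · obtain ⟨i, hi⟩ := hex
    obtain ⟨p, hp, h⟩ := exists_alternating T (fun t => w t i) t₀
    have hsub : Set.Icc 1 (l + 1) ⊆ Set.Icc 1 (r i t₀) := Set.Icc_subset_Icc_right hi
    exact ⟨i, p, hp.mono hsub, fun k hk => ⟨(h k (hsub hk)).1, (h k (hsub hk)).2.2⟩⟩
  · exfalso
    push Not at hex
    -- With at most l alternations per coordinate, the total count takes at most m * l + 1 values,
    -- so two positions share it. By monotonicity they then share every single count.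
    have hsum : ∀ t ∈ T, ∑ i, r i (t + 1) ∈ Finset.range (m * l + 1) := by
      intro t ht
      rw [Finset.mem_range]
      have : ∑ i, r i (t + 1) ≤ ∑ _i : Fin m, l := by
        refine Finset.sum_le_sum fun i _ => ?_
        have := alternations_mono T (fun t => w t i) (show t + 1 ≤ t₀ from ht₀ t ht)
        have := hex i
        simp only [r] at *
        omega
      simp at this
      omega
    obtain ⟨s, hs, t, ht, hst, he⟩ := Finset.exists_ne_map_eq_of_card_lt_of_maps_to
      (by rw [Finset.card_range]; omega) hsum
    -- The parity of the greedy count just after t is the letter at t, so equal counts force equal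
    -- words.
    have hdet : ∀ t ∈ T, ∀ i, w t i = decide (Even (r i (t + 1))) := by
      intro t ht i
      simp only [r, alternations]
      split_ifs with h
      · rw [h.2]
        simp [Nat.even_add_one]
      · have h' : w t i ≠ decide (Odd (alternations T (fun t => w t i) t)) := fun e => h ⟨ht, e⟩
        simp only [← Nat.not_odd_iff_even, decide_not]
        revert h'
        generalize decide (Odd (alternations T (fun t => w t i) t)) = b
        cases w t i <;> cases b <;> simp
    have main : ∀ s ∈ T, ∀ t ∈ T, s ≤ t → ∑ i, r i (s + 1) = ∑ i, r i (t + 1) → s = t := by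
      intro s hs t ht hle he
      refine hw hs ht (funext fun i => ?_)
      have := (Finset.sum_eq_sum_iff_of_le fun i _ =>
        alternations_mono T (fun t => w t i) (Nat.add_le_add_right hle 1)).1 he i
        (Finset.mem_univ i)
      rw [hdet s hs, hdet t ht]
      simp only [r, this]
    rcases le_total s t with h | h
    · exact hst (main s hs t ht h he)
    · exact hst (main t ht s hs h he.symm).symm

end Alternation

/-! ### Lattice points on a subdivided graph, their stars and cells. -/

section Lattice

variable {V : Type*}

open Classical in
/-- The point of the segment from `v` to `u` with barycentric coordinates `t` and `s`. -/
noncomputable def segPoint {R : Type*} [AddCommMonoid R] (u v : V) (t s : R) : V → R :=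
  Pi.single u t + Pi.single v s

theorem sum_segPoint [Fintype V] {R : Type*} [AddCommMonoid R] (u v : V) (t s : R) :
    ∑ w, segPoint u v t s w = t + s := by
  classical
  simp [segPoint, Finset.sum_add_distrib]

theorem segPoint_apply_left {R : Type*} [AddCommMonoid R] {u v : V} (h : u ≠ v) (t s : R) :
    segPoint u v t s u = t := by
  simp [segPoint, h]

theorem segPoint_apply_right {R : Type*} [AddCommMonoid R] {u v : V} (h : u ≠ v) (t s : R) :
    segPoint u v t s v = s := by
  simp [segPoint, h.symm]

theorem segPoint_apply_of_ne {R : Type*} [AddCommMonoid R] {u v w : V} (hu : w ≠ u) (hv : w ≠ v)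
    (t s : R) : segPoint u v t s w = 0 := by
  simp [segPoint, hu, hv]

theorem segPoint_self {R : Type*} [AddCommMonoid R] (u : V) (t s : R) :
    segPoint u u t s u = t + s := by
  simp [segPoint]

theorem eq_segPoint_of_support {R : Type*} [AddCommMonoid R] {u v : V} (h : u ≠ v) {a : V → R}
    (ha : ∀ w, a w ≠ 0 → w = u ∨ w = v) : a = segPoint u v (a u) (a v) := by
  ext w
  by_cases hu : w = u
  · rw [hu, segPoint_apply_left h]
  by_cases hv : w = v
  · rw [hv, segPoint_apply_right h]
  · rw [segPoint_apply_of_ne hu hv]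
    by_contra h0
    exact (ha w h0).elim hu hv

theorem eq_segPoint_self_of_support {R : Type*} [AddCommMonoid R] {u : V} {a : V → R}
    (ha : ∀ w, a w ≠ 0 → w = u ∨ w = u) : a = segPoint u u (a u) 0 := by
  ext w
  by_cases hu : w = u
  · rw [hu, segPoint_self, add_zero]
  · rw [segPoint_apply_of_ne hu hu]
    by_contra h0
    exact hu ((ha w h0).elim id id)

theorem natCast_segPoint (u v : V) (i j : ℕ) (w : V) :
    ((segPoint u v i j w : ℕ) : ℝ) = segPoint u v (i : ℝ) (j : ℝ) w := by
  classical
  simp only [segPoint, Pi.add_apply, Pi.single_apply]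
  split_ifs <;> simp

/-- The distance between two points with the same coordinate sum on a segment. -/
theorem abs_segPoint_sub_le (u v : V) (c t s : ℝ) (w : V) :
    |segPoint u v t (c - t) w - segPoint u v s (c - s) w| ≤ |t - s| := by
  classical
  simp only [segPoint, Pi.add_apply, Pi.single_apply]
  split_ifs
  · simp
  · simp
  · simp [abs_sub_comm]
  · simp

theorem mul_segPoint (N t s : ℝ) (u v w : V) :
    N * segPoint u v t s w = segPoint u v (N * t) (N * s) w := by
  classical
  simp only [segPoint, Pi.add_apply, Pi.single_apply]
  split_ifs <;> ring

variable [Fintype V]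

theorem mem_realization_iff {Γ : SimpleGraph V} {p : V → ℝ} :
    p ∈ realization Γ ↔ ∃ u v t, (u = v ∨ Γ.Adj u v) ∧ 0 ≤ t ∧ t ≤ 1 ∧
      p = segPoint u v t (1 - t) := by
  constructor
  · rintro ⟨h0, h1, u, v, huv, hs⟩
    by_cases h : u = v
    · subst h
      have e := eq_segPoint_self_of_support hs
      have : p u = 1 := by
        rw [e, sum_segPoint, add_zero] at h1
        exact h1
      exact ⟨u, u, 1, .inl rfl, zero_le_one, le_rfl, by rw [e, this, sub_self]⟩
    · have e := eq_segPoint_of_support h hs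
      have : p u + p v = 1 := by
        rwa [e, sum_segPoint] at h1
      refine ⟨u, v, p u, huv, h0 u, by linarith [h0 v], ?_⟩
      rw [← this, add_sub_cancel_left]
      exact e
  · rintro ⟨u, v, t, huv, h0, h1, rfl⟩
    refine ⟨fun w => ?_, by rw [sum_segPoint]; ring, u, v, huv, fun w hw => ?_⟩
    · classical
      simp only [segPoint, Pi.add_apply, Pi.single_apply]
      split_ifs <;> linarith
    · by_contra! hne
      exact hw (segPoint_apply_of_ne hne.1 hne.2 _ _)

/-- `a / N` is one of the points that subdivide each edge of `Γ` into `N` segments of equal length. -/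
def IsLatticePoint (Γ : SimpleGraph V) (N : ℕ) (a : V → ℕ) : Prop :=
  ∑ v, a v = N ∧ ∃ u v, (u = v ∨ Γ.Adj u v) ∧ ∀ w, a w ≠ 0 → w = u ∨ w = v

theorem isLatticePoint_segPoint {Γ : SimpleGraph V} {N i : ℕ} (hi : i ≤ N) {u v : V}
    (h : u = v ∨ Γ.Adj u v) : IsLatticePoint Γ N (segPoint u v i (N - i)) := by
  refine ⟨by rw [sum_segPoint]; omega, u, v, h, fun w hw => ?_⟩
  by_contra! hne
  exact hw (segPoint_apply_of_ne hne.1 hne.2 _ _)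

theorem eq_segPoint_of_sum {N : ℕ} {a : V → ℕ} {u v : V} (hs : ∑ v, a v = N)
    (ha : ∀ w, a w ≠ 0 → w = u ∨ w = v) : a u ≤ N ∧ a = segPoint u v (a u) (N - a u) := by
  by_cases h : u = v
  · subst h
    have e := eq_segPoint_self_of_support ha
    have : a u = N := by rwa [e, sum_segPoint, add_zero] at hs
    refine ⟨this.le, ?_⟩
    rw [this, Nat.sub_self, ← this]
    exact e
  · have e := eq_segPoint_of_support h ha
    have : a u + a v = N := by rwa [e, sum_segPoint] at hs
    refine ⟨by omega, ?_⟩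
    rw [← this, Nat.add_sub_cancel_left]
    exact e

theorem finite_isLatticePoint (Γ : SimpleGraph V) (N : ℕ) : {a | IsLatticePoint Γ N a}.Finite := by
  classical
  refine (Fintype.piFinset fun _ : V => Finset.range (N + 1)).finite_toSet.subset fun a ha => ?_
  simp only [Finset.mem_coe, Fintype.mem_piFinset, Finset.mem_range]
  intro v
  have := Finset.single_le_sum (f := a) (fun _ _ => Nat.zero_le _) (Finset.mem_univ v)
  rw [ha.1] at this
  omega

/-- The points of the realization at distance less than `2 / 3` from `a`, in units of `1 / N`. -/
def latticeStar (Γ : SimpleGraph V) (N : ℕ) (a : V → ℕ) : Set (realization Γ) :=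
  {p | ∀ w, |N * p.1 w - a w| < 2 / 3}

/-- The points of the realization at distance at most `1 / 2` from `a`, in units of `1 / N`. -/
def latticeCell (Γ : SimpleGraph V) (N : ℕ) (a : V → ℕ) : Set (realization Γ) :=
  {p | ∀ w, |N * p.1 w - a w| ≤ 1 / 2}

variable {Γ : SimpleGraph V} {N : ℕ}

/-- The radii: closed cells of radius 1 / 2 already cover, and 2 / 3 > 1 / 2 makes neighbouring
stars overlap at midpoints. Since 2 * (2 / 3) < 2, closed stars around points differing by 2 in some
coordinate are disjoint, and since 2 / 3 < 1, no nonzero coordinate of the centre vanishes anywhere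
on the star. -/
theorem latticeCell_subset_latticeStar (a : V → ℕ) : latticeCell Γ N a ⊆ latticeStar Γ N a :=
  fun _ hp w => (hp w).trans_lt (by norm_num)

theorem continuous_coord (w : V) : Continuous fun p : realization Γ => p.1 w :=
  (continuous_apply w).comp continuous_subtype_val

theorem isOpen_latticeStar (a : V → ℕ) : IsOpen (latticeStar Γ N a) := by
  simp only [latticeStar, Set.ofPred_forall]
  exact isOpen_iInter_of_finite fun w => isOpen_lt
    (((continuous_coord w).const_mul _).sub continuous_const).abs continuous_const

theorem isClosed_latticeCell (a : V → ℕ) : IsClosed (latticeCell Γ N a) := by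
  simp only [latticeCell, Set.ofPred_forall]
  exact isClosed_iInter fun w => isClosed_le
    (((continuous_coord w).const_mul _).sub continuous_const).abs continuous_const

theorem closure_preimage_latticeStar_subset {X : Type*} [TopologicalSpace X] {g : X → realization Γ}
    (hg : Continuous g) (a : V → ℕ) :
    closure (g ⁻¹' latticeStar Γ N a) ⊆ {x | ∀ w, |N * (g x).1 w - a w| ≤ 2 / 3} := by
  refine closure_minimal (fun x hx w => (hx w).le) ?_
  simp only [Set.ofPred_forall]
  exact isClosed_iInter fun w => isClosed_le
    ((((continuous_coord w).comp hg).const_mul _).sub continuous_const).abs continuous_const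

theorem exists_mem_latticeCell (p : realization Γ) :
    ∃ a, IsLatticePoint Γ N a ∧ p ∈ latticeCell Γ N a := by
  obtain ⟨u, v, t, huv, h0, h1, hp⟩ := mem_realization_iff.1 p.2
  have hN : (0 : ℝ) ≤ N := by positivity
  have hNt : N * t ≤ N := by nlinarith
  set i := ⌊N * t + 1 / 2⌋₊ with hi
  have hle : (i : ℝ) ≤ N * t + 1 / 2 := Nat.floor_le (by positivity)
  have hlt : N * t + 1 / 2 < i + 1 := Nat.lt_floor_add_one _
  have hiN : i ≤ N := by
    have : (i : ℝ) < N + 1 := by linarith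
    exact Nat.lt_succ_iff.1 (by exact_mod_cast this)
  refine ⟨_, isLatticePoint_segPoint hiN huv, fun w => ?_⟩
  rw [hp, mul_segPoint, natCast_segPoint, Nat.cast_sub hiN, mul_sub, mul_one]
  refine (abs_segPoint_sub_le u v N _ _ w).trans ?_
  rw [abs_le]
  constructor <;> linarith

/-- A natural coordinate that is within `1` of a vanishing coordinate vanishes. -/
theorem eq_zero_of_abs_lt {p : ℝ} {a : ℕ} (hp : p = 0) (h : |N * p - a| < 1) : a = 0 := by
  rw [hp, mul_zero, zero_sub, abs_neg, Nat.abs_cast] at h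
  have : a < 1 := by exact_mod_cast h
  omega

theorem isLatticePoint_mem_latticeStar (hN : 0 < N) {a : V → ℕ} (ha : IsLatticePoint Γ N a) :
    ∃ p ∈ latticeStar Γ N a, ∀ w, N * p.1 w = a w := by
  obtain ⟨hs, u, v, huv, hsupp⟩ := ha
  obtain ⟨hle, e⟩ := eq_segPoint_of_sum hs hsupp
  have hN' : (0 : ℝ) < N := by exact_mod_cast hN
  have hle' : (a u : ℝ) ≤ N := by exact_mod_cast hle
  have key : ∀ w, N * segPoint u v ((a u : ℝ) / N) (1 - (a u : ℝ) / N) w = a w := by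
    intro w
    rw [mul_segPoint]
    conv_rhs => rw [e]
    rw [natCast_segPoint, Nat.cast_sub hle, mul_sub, mul_one, mul_div_cancel₀ _ hN'.ne']
  refine ⟨⟨segPoint u v ((a u : ℝ) / N) (1 - (a u : ℝ) / N), mem_realization_iff.2
    ⟨u, v, _, huv, by positivity, by rwa [div_le_one hN'], rfl⟩⟩, fun w => ?_, key⟩
  rw [key, sub_self, abs_zero]
  norm_num

theorem eq_of_latticeStar_eq (hN : 0 < N) {a b : V → ℕ} (ha : IsLatticePoint Γ N a)
    (h : latticeStar Γ N a = latticeStar Γ N b) : a = b := by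
  obtain ⟨p, hp, e⟩ := isLatticePoint_mem_latticeStar hN ha
  rw [h] at hp
  ext w
  have := hp w
  rw [e, abs_lt] at this
  have h1 : (a w : ℝ) < b w + 1 := by linarith
  have h2 : (b w : ℝ) < a w + 1 := by linarith
  have h1' : a w < b w + 1 := by exact_mod_cast h1
  have h2' : b w < a w + 1 := by exact_mod_cast h2
  omega

/-- Lattice points with intersecting stars are close and lie on a common edge. -/
theorem exists_edge_of_inter {a b : V → ℕ}
    (h : (latticeStar Γ N a ∩ latticeStar Γ N b).Nonempty) :
    ∃ u v, (u = v ∨ Γ.Adj u v) ∧ (∀ w, a w ≠ 0 → w = u ∨ w = v) ∧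
      (∀ w, b w ≠ 0 → w = u ∨ w = v) ∧ ∀ w, |(a w : ℝ) - b w| ≤ 1 := by
  obtain ⟨p, hpa, hpb⟩ := h
  obtain ⟨u, v, huv, hp⟩ := p.2.2.2
  refine ⟨u, v, huv, fun w hw => ?_, fun w hw => ?_, fun w => ?_⟩
  · by_contra hne
    exact hw (eq_zero_of_abs_lt (not_not.1 fun h0 => hne (hp w h0))
      ((hpa w).trans (by norm_num)))
  · by_contra hne
    exact hw (eq_zero_of_abs_lt (not_not.1 fun h0 => hne (hp w h0))
      ((hpb w).trans (by norm_num)))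
  · have h1 := abs_lt.1 (hpa w)
    have h2 := abs_lt.1 (hpb w)
    have h3 : (a w : ℝ) < b w + 2 := by linarith
    have h4 : (b w : ℝ) < a w + 2 := by linarith
    have h3' : a w < b w + 2 := by exact_mod_cast h3
    have h4' : b w < a w + 2 := by exact_mod_cast h4
    have h3'' : (a w : ℝ) ≤ b w + 1 := by exact_mod_cast Nat.lt_succ_iff.1 h3'
    have h4'' : (b w : ℝ) ≤ a w + 1 := by exact_mod_cast Nat.lt_succ_iff.1 h4'
    rw [abs_le]
    constructor <;> linarith

theorem latticeStar_inter_nonempty {i : ℕ} (hi : i < N) {u v : V} (h : u = v ∨ Γ.Adj u v) :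
    (latticeStar Γ N (segPoint u v i (N - i)) ∩
      latticeStar Γ N (segPoint u v (i + 1) (N - (i + 1)))).Nonempty := by
  have hN' : (0 : ℝ) < N := by exact_mod_cast (by omega : 0 < N)
  have hi' : (i : ℝ) + 1 ≤ N := by exact_mod_cast hi
  refine ⟨⟨segPoint u v ((i + 1 / 2) / N : ℝ) (1 - (i + 1 / 2) / N), mem_realization_iff.2
    ⟨u, v, _, h, by positivity, by rw [div_le_one hN']; linarith, rfl⟩⟩, fun w => ?_, fun w => ?_⟩
  · rw [mul_segPoint, natCast_segPoint, Nat.cast_sub hi.le, mul_sub, mul_one,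
      mul_div_cancel₀ _ hN'.ne']
    refine (abs_segPoint_sub_le u v N _ _ w).trans_lt ?_
    rw [abs_lt]
    constructor <;> linarith
  · rw [mul_segPoint, natCast_segPoint, Nat.cast_sub (by omega : i + 1 ≤ N), mul_sub, mul_one,
      mul_div_cancel₀ _ hN'.ne']
    refine (abs_segPoint_sub_le u v N _ _ w).trans_lt ?_
    push_cast
    rw [abs_lt]
    constructor <;> linarith

end Lattice

/-! ### Subdividing a graph does not change its realization. -/

section Subdivision

variable {V U : Type*} [Fintype V] {Γ : SimpleGraph V} {N : ℕ}

theorem one_le_norm_of_ne {a b : V → ℕ} (h : a ≠ b) : 1 ≤ ‖fun w => (a w : ℝ) - b w‖ := by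
  obtain ⟨w, hw⟩ := Function.ne_iff.1 h
  refine le_trans ?_ (norm_le_pi_norm _ w)
  rw [Real.norm_eq_abs, show ((a w : ℝ) - b w) = ((a w - b w : ℤ) : ℝ) by push_cast; rfl,
    ← Int.cast_abs]
  have : (a w : ℤ) - b w ≠ 0 := by omega
  exact_mod_cast Int.one_le_abs this

/-- The barycentric coordinates, with respect to the lattice points, of a point between two
neighbouring lattice points are tent functions. -/
theorem segPoint_eq_tent {b : U → V → ℕ} (hb : ∀ z, IsLatticePoint Γ N (b z))
    (hinj : Function.Injective b) {x y : U} {s : ℝ} (h0 : 0 ≤ s) (h1 : s ≤ 1)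
    (hxy : x = y ∨ (latticeStar Γ N (b x) ∩ latticeStar Γ N (b y)).Nonempty) (z : U) :
    segPoint x y s (1 - s) z
      = max 0 (1 - ‖fun w => s * b x w + (1 - s) * b y w - b z w‖) := by
  by_cases hne : x = y
  · subst hne
    have e : (fun w => s * (b x w : ℝ) + (1 - s) * b x w - b z w)
        = fun w => (b x w : ℝ) - b z w := by
      ext w; ring
    rw [e]
    by_cases hz : z = x
    · subst hz
      have : (fun w => (b z w : ℝ) - b z w) = 0 := by ext w; simp
      rw [segPoint_self, this, norm_zero]
      simp
    · have := one_le_norm_of_ne (hinj.ne (Ne.symm hz))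
      rw [segPoint_apply_of_ne hz hz, max_eq_left (by linarith)]
  obtain ⟨u, v, huv, hx, hy, hd⟩ := exists_edge_of_inter (hxy.resolve_left hne)
  have hxy1 : ‖fun w => (b x w : ℝ) - b y w‖ = 1 :=
    le_antisymm ((pi_norm_le_iff_of_nonneg zero_le_one).2 hd) (one_le_norm_of_ne (hinj.ne hne))
  by_cases hzx : z = x
  · subst hzx
    have e : (fun w => s * (b z w : ℝ) + (1 - s) * b y w - b z w)
        = (-(1 - s)) • fun w => (b z w : ℝ) - b y w := by
      ext w; simp only [Pi.smul_apply, smul_eq_mul]; ring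
    rw [e, norm_smul, hxy1, segPoint_apply_left hne, norm_neg, Real.norm_eq_abs,
      abs_of_nonneg (by linarith), max_eq_right (by linarith)]
    ring
  by_cases hzy : z = y
  · subst hzy
    have e : (fun w => s * (b x w : ℝ) + (1 - s) * b z w - b z w)
        = s • fun w => (b x w : ℝ) - b z w := by
      ext w; simp only [Pi.smul_apply, smul_eq_mul]; ring
    rw [e, norm_smul, hxy1, segPoint_apply_right hne, Real.norm_eq_abs,
      abs_of_nonneg (by linarith), max_eq_right (by linarith)]
    ring
  rw [segPoint_apply_of_ne hzx hzy, max_eq_left]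
  suffices h : ∃ w, 1 ≤ |s * (b x w : ℝ) + (1 - s) * b y w - b z w| by
    obtain ⟨w, hw⟩ := h
    have := norm_le_pi_norm (fun w => s * (b x w : ℝ) + (1 - s) * b y w - b z w) w
    rw [Real.norm_eq_abs] at this
    linarith
  -- If z lies on the same edge, its integer coordinate lies on one side of the two neighbouring
  -- ones; otherwise z has a positive coordinate where both x and y vanish.
  by_cases hz : ∀ w, b z w ≠ 0 → w = u ∨ w = v
  · refine ⟨u, ?_⟩
    obtain ⟨-, ex⟩ := eq_segPoint_of_sum (hb x).1 hx
    obtain ⟨-, ey⟩ := eq_segPoint_of_sum (hb y).1 hy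
    obtain ⟨-, ez⟩ := eq_segPoint_of_sum (hb z).1 hz
    have n1 : b x u ≠ b y u := fun h => hne (hinj (by rw [ex, ey, h]))
    have n2 : b z u ≠ b x u := fun h => hzx (hinj (by rw [ez, ex, h]))
    have n3 : b z u ≠ b y u := fun h => hzy (hinj (by rw [ez, ey, h]))
    have hdu := abs_le.1 (hd u)
    generalize b x u = i at *
    generalize b y u = j at *
    generalize b z u = k at *
    have d1 : (i : ℝ) ≤ j + 1 := by linarith
    have d2 : (j : ℝ) ≤ i + 1 := by linarith
    have d1' : i ≤ j + 1 := by exact_mod_cast d1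
    have d2' : j ≤ i + 1 := by exact_mod_cast d2
    rw [le_abs]
    rcases lt_or_gt_of_ne n2 with hk | hk
    · left
      have k1 : (k : ℝ) + 1 ≤ i := by exact_mod_cast hk
      have k2 : (k : ℝ) + 1 ≤ j := by exact_mod_cast (by omega : k + 1 ≤ j)
      nlinarith
    · right
      have k1 : (i : ℝ) + 1 ≤ k := by exact_mod_cast hk
      have k2 : (j : ℝ) + 1 ≤ k := by exact_mod_cast (by omega : j + 1 ≤ k)
      nlinarith
  · push Not at hz
    obtain ⟨w, hw, hwu, hwv⟩ := hz
    refine ⟨w, ?_⟩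
    have ex : b x w = 0 := by
      by_contra h; exact (hx w h).elim hwu hwv
    have ey : b y w = 0 := by
      by_contra h; exact (hy w h).elim hwu hwv
    have : (1 : ℝ) ≤ b z w := by exact_mod_cast Nat.one_le_iff_ne_zero.2 hw
    rw [ex, ey, le_abs]
    right
    push_cast
    linarith

variable [Fintype U]

theorem sum_segPoint_mul (x y : U) (t s : ℝ) (c : U → ℝ) :
    ∑ z, segPoint x y t s z * c z = t * c x + s * c y := by
  classical
  simp [segPoint, add_mul, Finset.sum_add_distrib, Pi.single_apply]

/-- A graph whose vertices are the lattice points, with the adjacency of the nerve of their stars, has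
the same realization as `Γ`. -/
theorem nonempty_homeomorph_realization (hN : 0 < N) {Δ : SimpleGraph U} {b : U → V → ℕ}
    (hb : ∀ z, IsLatticePoint Γ N (b z)) (hinj : Function.Injective b)
    (hsurj : ∀ a, IsLatticePoint Γ N a → ∃ z, b z = a)
    (hadj : ∀ x y, Δ.Adj x y ↔
      x ≠ y ∧ (latticeStar Γ N (b x) ∩ latticeStar Γ N (b y)).Nonempty) :
    Nonempty (realization Δ ≃ₜ realization Γ) := by
  have hN' : (0 : ℝ) < N := by exact_mod_cast hN
  -- φ extends the placement of the lattice points linearly, and the tent functions τ give a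
  -- continuous inverse.
  let φ : (U → ℝ) → V → ℝ := fun P w => (∑ z, P z * b z w) / N
  let τ : (V → ℝ) → U → ℝ := fun p z => max 0 (1 - ‖fun w => N * p w - b z w‖)
  have hφ : Continuous φ := by fun_prop
  have hτ : Continuous τ := by fun_prop
  have hφseg : ∀ x y s w, φ (segPoint x y s (1 - s)) w = (s * b x w + (1 - s) * b y w) / N := by
    intro x y s w
    simp only [φ, sum_segPoint_mul]
  have hedge : ∀ {x y}, (x = y ∨ Δ.Adj x y) →
      x = y ∨ (latticeStar Γ N (b x) ∩ latticeStar Γ N (b y)).Nonempty := by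
    rintro x y (h | h)
    · exact .inl h
    · exact .inr ((hadj x y).1 h).2
  have hφmem : ∀ P ∈ realization Δ, φ P ∈ realization Γ := by
    intro P hP
    obtain ⟨x, y, s, hxy, h0, h1, rfl⟩ := mem_realization_iff.1 hP
    obtain ⟨u, v, huv, hx, hy⟩ : ∃ u v, (u = v ∨ Γ.Adj u v) ∧
        (∀ w, b x w ≠ 0 → w = u ∨ w = v) ∧ ∀ w, b y w ≠ 0 → w = u ∨ w = v := by
      rcases hedge hxy with rfl | h
      · obtain ⟨-, u, v, huv, hx⟩ := hb x
        exact ⟨u, v, huv, hx, hx⟩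
      · obtain ⟨u, v, huv, hx, hy, -⟩ := exists_edge_of_inter h
        exact ⟨u, v, huv, hx, hy⟩
    refine ⟨fun w => ?_, ?_, u, v, huv, fun w hw => ?_⟩
    · rw [hφseg]
      have : 0 ≤ 1 - s := by linarith
      positivity
    · simp only [hφseg]
      rw [← Finset.sum_div, Finset.sum_add_distrib, ← Finset.mul_sum, ← Finset.mul_sum,
        ← Nat.cast_sum, ← Nat.cast_sum, (hb x).1, (hb y).1]
      field_simp
      ring
    · by_contra hne
      refine hw ?_
      have ex : b x w = 0 := by
        by_contra h; exact hne (hx w h)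
      have ey : b y w = 0 := by
        by_contra h; exact hne (hy w h)
      rw [hφseg, ex, ey]
      simp
  have hτφ : ∀ P ∈ realization Δ, τ (φ P) = P := by
    intro P hP
    obtain ⟨x, y, s, hxy, h0, h1, rfl⟩ := mem_realization_iff.1 hP
    ext z
    rw [segPoint_eq_tent hb hinj h0 h1 (hedge hxy)]
    simp only [τ, hφseg]
    congr 3
    ext w
    rw [mul_div_cancel₀ _ hN'.ne']
  have hφsurj : ∀ p ∈ realization Γ, ∃ P ∈ realization Δ, φ P = p := by
    intro p hp
    obtain ⟨u, v, t, huv, h0, h1, rfl⟩ := mem_realization_iff.1 hp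
    have hNt : N * t ≤ N := by nlinarith
    -- The index of the segment containing t; at the endpoint t = 1 the floor is N, and the last
    -- segment N - 1 is used.
    obtain ⟨i, hiN, hi0, hi1⟩ : ∃ i : ℕ, i < N ∧ (i : ℝ) ≤ N * t ∧ N * t ≤ i + 1 := by
      rcases lt_or_ge ⌊N * t⌋₊ N with h | h
      · exact ⟨_, h, Nat.floor_le (by positivity), (Nat.lt_floor_add_one _).le⟩
      · have h2 : (N : ℝ) ≤ N * t := (Nat.cast_le.2 h).trans (Nat.floor_le (by positivity))
        have e : ((N - 1 : ℕ) : ℝ) = N - 1 := by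
          rw [Nat.cast_sub (by omega)]; simp
        exact ⟨N - 1, by omega, by rw [e]; linarith, by rw [e]; linarith⟩
    obtain ⟨x, hx⟩ := hsurj _ (isLatticePoint_segPoint hiN.le huv)
    obtain ⟨y, hy⟩ := hsurj _ (isLatticePoint_segPoint (i := i + 1) hiN huv)
    refine ⟨segPoint x y (1 - (N * t - i)) (1 - (1 - (N * t - i))), mem_realization_iff.2
      ⟨x, y, _, ?_, by linarith, by linarith, rfl⟩, ?_⟩
    · by_cases hxy : x = y
      · exact .inl hxy
      · refine .inr ((hadj x y).2 ⟨hxy, ?_⟩)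
        rw [hx, hy]
        exact latticeStar_inter_nonempty hiN huv
    · ext w
      rw [hφseg, hx, hy, div_eq_iff hN'.ne', mul_comm _ (N : ℝ), mul_segPoint, natCast_segPoint,
        natCast_segPoint, Nat.cast_sub hiN.le, Nat.cast_sub (by omega : i + 1 ≤ N), mul_segPoint,
        mul_segPoint]
      classical
      simp only [segPoint, Pi.add_apply, Pi.single_apply]
      push_cast
      split_ifs <;> ring
  have hτmem : ∀ p ∈ realization Γ, τ p ∈ realization Δ ∧ φ (τ p) = p := by
    intro p hp
    obtain ⟨P, hP, rfl⟩ := hφsurj p hp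
    rw [hτφ P hP]
    exact ⟨hP, rfl⟩
  exact ⟨{ toFun := fun P => ⟨φ P, hφmem P P.2⟩
           invFun := fun p => ⟨τ p, (hτmem p p.2).1⟩
           left_inv := fun P => Subtype.ext (hτφ P P.2)
           right_inv := fun p => Subtype.ext (hτmem p p.2).2
           continuous_toFun := (hφ.comp continuous_subtype_val).subtype_mk _
           continuous_invFun := (hτ.comp continuous_subtype_val).subtype_mk _ }⟩

end Subdivision

/-! ### The star cover of X, its nerve, and free chains along an edge. -/

section Cover

variable {V X : Type*} [Fintype V] {Γ : SimpleGraph V} {N : ℕ}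

/-- The lattice points, as a finite set. -/
noncomputable def latticePoints (Γ : SimpleGraph V) (N : ℕ) : Finset (V → ℕ) :=
  (finite_isLatticePoint Γ N).toFinset

theorem mem_latticePoints {a : V → ℕ} : a ∈ latticePoints Γ N ↔ IsLatticePoint Γ N a := by
  simp [latticePoints]

open Classical in
/-- The cover of `X` by the preimages of the stars of the lattice points. -/
noncomputable def starCover (N : ℕ) (g : X → realization Γ) : Finset (Set X) :=
  (latticePoints Γ N).image fun a => g ⁻¹' latticeStar Γ N a

theorem mem_starCover {g : X → realization Γ} {S : Set X} :
    S ∈ starCover N g ↔ ∃ a, IsLatticePoint Γ N a ∧ g ⁻¹' latticeStar Γ N a = S := by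
  classical
  simp [starCover, mem_latticePoints]

/-- Points whose images under `g` are close, at the scale of the subdivision into `N` parts, have
distance less than `ε`. -/
def IsFine [MetricSpace X] (N : ℕ) (g : X → realization Γ) (ε : ℝ) : Prop :=
  ∀ x y, (∀ w, |N * (g x).1 w - N * (g y).1 w| < 4 / 3) → dist x y < ε

theorem IsFine.dist_lt [MetricSpace X] {g : X → realization Γ} {ε : ℝ} (hg : IsFine N g ε)
    {a : V → ℕ} {x y : X} (hx : g x ∈ latticeStar Γ N a) (hy : g y ∈ latticeStar Γ N a) :
    dist x y < ε := by
  refine hg x y fun w => ?_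
  have h1 := abs_lt.1 (hx w)
  have h2 := abs_lt.1 (hy w)
  rw [abs_lt]
  constructor <;> linarith

theorem isEpsCover_starCover [MetricSpace X] {g : X → realization Γ} {ε δ : ℝ} (hg : Continuous g)
    (hδ : 0 < δ) (hδε : δ < ε) (hfine : IsFine N g δ) : IsEpsCover ε (starCover N g) := by
  refine ⟨fun S hS => ?_, fun x => ?_⟩
  · obtain ⟨a, -, rfl⟩ := mem_starCover.1 hS
    exact ⟨(isOpen_latticeStar a).preimage hg, (Metric.diam_le_of_forall_dist_le hδ.le
      fun x hx y hy => (hfine.dist_lt hx hy).le).trans_lt hδε⟩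
  · obtain ⟨a, ha, hx⟩ := exists_mem_latticeCell (N := N) (g x)
    exact ⟨_, mem_starCover.2 ⟨a, ha, rfl⟩, latticeCell_subset_latticeStar a hx⟩

theorem eq_of_preimage_latticeStar_eq (hN : 0 < N) {g : X → realization Γ}
    (hg : Function.Surjective g) {a b : V → ℕ} (ha : IsLatticePoint Γ N a)
    (h : g ⁻¹' latticeStar Γ N a = g ⁻¹' latticeStar Γ N b) : a = b :=
  eq_of_latticeStar_eq hN ha (hg.preimage_injective h)

/-- By surjectivity of g, preimages of stars are distinct and intersect exactly as the stars do, so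
the nerve is the subdivided graph. -/
theorem nonempty_homeomorph_realization_nerve (hN : 0 < N) {g : X → realization Γ}
    (hg : Function.Surjective g) :
    Nonempty (realization (nerve (starCover N g)) ≃ₜ realization Γ) := by
  have h : ∀ S : starCover N g, ∃ a, IsLatticePoint Γ N a ∧ g ⁻¹' latticeStar Γ N a = S :=
    fun S => mem_starCover.1 S.2
  choose b hb hbS using h
  refine nonempty_homeomorph_realization hN hb (fun S T hST => ?_) (fun a ha => ?_) fun S T => ?_
  · rw [← Subtype.coe_inj, ← hbS, ← hbS, hST]
  · exact ⟨⟨_, mem_starCover.2 ⟨a, ha, rfl⟩⟩, eq_of_preimage_latticeStar_eq hN hg (hb _) (hbS _)⟩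
  · refine and_congr_right fun _ => ?_
    rw [← hbS, ← hbS, ← Set.preimage_inter]
    refine ⟨fun ⟨x, hx⟩ => ⟨g x, hx⟩, fun h => h.preimage hg⟩

/-- The links of the chain that runs along an edge, from the lattice point with index `s`. -/
noncomputable def edgeLink (N : ℕ) (g : X → realization Γ) (u v : V) (s k : ℕ) : Set X :=
  g ⁻¹' latticeStar Γ N (segPoint u v (s + k - 1) (N - (s + k - 1)))

theorem isFreeChainIn_edgeLink [TopologicalSpace X] (hN : 0 < N) {g : X → realization Γ}
    (hg : Continuous g) (hsurj : Function.Surjective g) {u v : V} (huv : Γ.Adj u v) {s n : ℕ}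
    (hn : 1 ≤ n) (hsn : s + n ≤ N + 1) :
    IsFreeChainIn (starCover N g) n (edgeLink N g u v s) := by
  have hlat : ∀ k ∈ Set.Icc 1 n,
      IsLatticePoint Γ N (segPoint u v (s + k - 1) (N - (s + k - 1))) := by
    intro k hk
    simp only [Set.mem_Icc] at hk
    exact isLatticePoint_segPoint (by omega) (.inr huv)
  have hclos : ∀ {a : V → ℕ} {x : X}, x ∈ closure (g ⁻¹' latticeStar Γ N a) →
      ∀ w, -(2 / 3) ≤ N * (g x).1 w - a w ∧ N * (g x).1 w - a w ≤ 2 / 3 :=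
    fun h w => abs_le.1 (closure_preimage_latticeStar_subset hg _ h w)
  have hnear : ∀ {a b : V → ℕ},
      (closure (g ⁻¹' latticeStar Γ N a) ∩ closure (g ⁻¹' latticeStar Γ N b)).Nonempty →
      ∀ w, a w ≤ b w + 1 := by
    rintro a b ⟨x, ha, hb⟩ w
    have h1 := hclos ha w
    have h2 := hclos hb w
    have : (a w : ℝ) < b w + 2 := by linarith
    have : a w < b w + 2 := by exact_mod_cast this
    omega
  refine ⟨⟨hn, fun k hk => mem_starCover.2 ⟨_, hlat k hk, rfl⟩, fun i hi j hj hij => ?_,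
    fun i hi hin => ?_, fun i hi j hj hij => ?_⟩, fun i hi hin S hS hSi => ?_⟩
  · have := congrFun (eq_of_preimage_latticeStar_eq hN hsurj (hlat i hi) hij) u
    rw [segPoint_apply_left huv.ne, segPoint_apply_left huv.ne] at this
    simp only [Set.mem_Icc] at hi hj
    omega
  · have := (latticeStar_inter_nonempty (N := N) (i := s + i - 1) (by omega)
      (.inr huv : u = v ∨ Γ.Adj u v)).preimage hsurj
    rwa [show s + i - 1 + 1 = s + (i + 1) - 1 by omega] at this
  · have h1 := hnear hij u
    have h2 := hnear (Set.inter_comm _ _ ▸ hij) u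
    rw [segPoint_apply_left huv.ne, segPoint_apply_left huv.ne] at h1 h2
    simp only [Set.mem_Icc] at hi hj
    omega
  · obtain ⟨b, hb, rfl⟩ := mem_starCover.1 hS
    have h1 := hnear hSi u
    have h2 := hnear (Set.inter_comm _ _ ▸ hSi) u
    rw [segPoint_apply_left huv.ne] at h1 h2
    obtain ⟨x, hxb, hxi⟩ := hSi
    -- An interior link is centred inside the edge, so its closure maps into the open edge. Any
    -- member whose closure meets it therefore has its centre on that edge, at most one step away.
    have hpos : ∀ w, 1 ≤ segPoint u v (s + i - 1) (N - (s + i - 1)) w → (g x).1 w ≠ 0 := by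
      intro w hw h0
      have := hclos hxi w
      rw [h0, mul_zero] at this
      have hw' : (1 : ℝ) ≤ (segPoint u v (s + i - 1) (N - (s + i - 1)) w : ℕ) := by
        exact_mod_cast hw
      linarith
    have hu := hpos u (by rw [segPoint_apply_left huv.ne]; omega)
    have hv := hpos v (by rw [segPoint_apply_right huv.ne]; omega)
    obtain ⟨u', v', -, hsupp⟩ := (g x).2.2.2
    have hsupp' : ∀ w, (g x).1 w ≠ 0 → w = u ∨ w = v := by
      intro w hw
      have h3 := hsupp w hw
      have h4 := hsupp u hu
      have h5 := hsupp v hv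
      have := huv.ne
      grind
    have hbs : ∀ w, b w ≠ 0 → w = u ∨ w = v := by
      intro w hw
      by_contra hne
      refine hw (eq_zero_of_abs_lt (N := N) (not_not.1 fun h0 => hne (hsupp' w h0)) ?_)
      have := closure_preimage_latticeStar_subset hg _ hxb w
      exact lt_of_le_of_lt this (by norm_num)
    obtain ⟨-, e⟩ := eq_segPoint_of_sum hb.1 hbs
    have hcase : b u = s + (i - 1) - 1 ∨ b u = s + i - 1 ∨ b u = s + (i + 1) - 1 := by omega
    unfold edgeLink
    rcases hcase with h | h | h
    · left; rw [e, h]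
    · right; left; rw [e, h]
    · right; right; rw [e, h]

/-- On the compact set of pairs at distance at least ε the images stay a positive distance δ apart,
because fibres have diameter less than ε. Then N is taken with 4 / 3 < N * δ. -/
theorem exists_isFine [MetricSpace X] [CompactSpace X] {G : Type*} [TopologicalSpace G]
    (hX : IsLike X G) (e : G ≃ₜ realization Γ) {ε : ℝ} (hε : 0 < ε) :
    ∃ N : ℕ, 0 < N ∧ ∃ g : X → realization Γ, Continuous g ∧ Function.Surjective g ∧
      IsFine N g ε := by
  obtain ⟨g, hg, hsurj, hfib⟩ := hX ε hε
  have hc : Continuous (e ∘ g) := e.continuous.comp hg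
  obtain ⟨δ, hδ, hδg⟩ : ∃ δ > 0, ∀ x y : X, dist (e (g x)) (e (g y)) < δ → dist x y < ε := by
    let D : Set (X × X) := {q : X × X | ε ≤ dist q.1 q.2}
    have hD : IsCompact D := (isClosed_le continuous_const continuous_dist).isCompact
    rcases D.eq_empty_or_nonempty with h | h
    · refine ⟨1, one_pos, fun x y _ => not_le.1 fun hle => ?_⟩
      have : (x, y) ∈ D := hle
      simp [h] at this
    · obtain ⟨q, hq, hmin⟩ := hD.exists_isMinOn h
        (f := fun q : X × X => dist (e (g q.1)) (e (g q.2)))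
        ((hc.comp continuous_fst).dist (hc.comp continuous_snd)).continuousOn
      refine ⟨dist (e (g q.1)) (e (g q.2)), dist_pos.2 fun heq => ?_, fun x y hxy => not_le.1 fun hle => ?_⟩
      · have h1 : g q.1 = g q.2 := e.injective heq
        have h2 : dist q.1 q.2 ≤ Metric.diam (g ⁻¹' {g q.2}) :=
          Metric.dist_le_diam_of_mem (Metric.isBounded_of_compactSpace) h1 rfl
        have h3 : ε ≤ dist q.1 q.2 := hq
        linarith [hfib (g q.2)]
      · exact absurd hxy (not_lt.2 (hmin (show (x, y) ∈ D from hle)))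
  obtain ⟨N, hN⟩ := exists_nat_gt (4 / 3 / δ)
  have hN' : (0 : ℝ) < N := lt_trans (by positivity) hN
  refine ⟨N, by exact_mod_cast hN', e ∘ g, hc, e.surjective.comp hsurj, fun x y hxy => ?_⟩
  refine hδg x y ?_
  rw [Subtype.dist_eq, dist_pi_lt_iff hδ]
  intro w
  have := hxy w
  rw [← mul_sub, abs_mul, Nat.abs_cast] at this
  rw [div_lt_iff₀ hδ] at hN
  rw [Real.dist_eq]
  exact lt_of_mul_lt_mul_left (this.trans hN) hN'.le

end Cover

theorem HasISPD.mono {X : Type*} [Nonempty X] {f : X → X} {𝒜 ℬ : Set (Set X)} (h : HasISPD f 𝒜)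
    (hℬ : ∀ S ∈ ℬ, ∃ T ∈ 𝒜, T ⊆ S) : HasISPD f ℬ := by
  obtain ⟨I, hI, hJ⟩ := h
  refine ⟨I, hI, fun J hJI Y hY => ?_⟩
  rcases J.eq_empty_or_nonempty with rfl | ⟨j₀, hj₀⟩
  · exact ⟨Classical.arbitrary X, by simp⟩
  obtain ⟨T₀, -⟩ := hℬ _ (hY j₀ hj₀)
  have : ∀ j, ∃ T, j ∈ J → T ∈ 𝒜 ∧ T ⊆ Y j := fun j => by
    by_cases hj : j ∈ J
    · obtain ⟨T, hT⟩ := hℬ _ (hY j hj)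
      exact ⟨T, fun _ => hT⟩
    · exact ⟨T₀, fun h => absurd h hj⟩
  choose T hT using this
  obtain ⟨x, hx⟩ := hJ J hJI T fun j hj => (hT j hj).1
  simp only [Set.mem_iInter] at hx
  exact ⟨x, by simpa using fun j hj => (hT j hj).2 (hx j hj)⟩

/-- Keep the first l marked links and jump from there to the last one; the parities agree because l
+ 1 and l' + 1 are both even. -/
theorem IsZigzag.mono {X : Type*} [Nonempty X] {f : X → X} {l l' n : ℕ} {C : ℕ → Set X}
    {U U' V V' : Set X} (h : IsZigzag f l' n C U V) (hl : l ≤ l') (hodd : Odd l) (hodd' : Odd l')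
    (hU : U ⊆ U') (hV : V ⊆ V') : IsZigzag f l n C U' V' := by
  obtain ⟨k, hk1, hkn, hmono, hoddk, hevenk, hispd⟩ := h
  let r : ℕ → ℕ := fun i => if i ≤ l then i else l' + 1
  have hl1 : 1 ≤ l := hodd.pos
  have hr : ∀ i ∈ Set.Icc 1 (l + 1), r i ∈ Set.Icc 1 (l' + 1) ∧ (Even (r i) ↔ Even i) := by
    intro i hi
    simp only [Set.mem_Icc] at hi
    simp only [r, Set.mem_Icc]
    split_ifs with h
    · exact ⟨⟨hi.1, by omega⟩, Iff.rfl⟩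
    · obtain rfl : i = l + 1 := by omega
      exact ⟨⟨by omega, le_rfl⟩, by simp [hodd.add_one, hodd'.add_one]⟩
  have hrodd : ∀ i ∈ Set.Icc 1 (l + 1), Odd i → Odd (r i) := fun i hi h => by
    rw [← Nat.not_even_iff_odd, (hr i hi).2, Nat.not_even_iff_odd]
    exact h
  refine ⟨fun i => k (r i), by simp [r, hl1, hk1], by simp [r, hkn], ?_, ?_, ?_, ?_⟩
  · intro i hi j hj hij
    refine hmono (hr i hi).1 (hr j hj).1 ?_
    simp only [Set.mem_Icc] at hi hj
    simp only [r]
    split_ifs <;> omega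
  · intro i hi h
    exact (hoddk _ (hr i hi).1 (hrodd i hi h)).mono (Set.inter_subset_inter_right _ hU)
  · intro i hi h
    exact (hevenk _ (hr i hi).1 ((hr i hi).2.2 h)).mono (Set.inter_subset_inter_right _ hV)
  · refine hispd.mono ?_
    rintro S (⟨i, hi, h, rfl⟩ | ⟨i, hi, h, rfl⟩)
    · exact ⟨_, .inl ⟨r i, (hr i hi).1, hrodd i hi h, rfl⟩, Set.inter_subset_inter_right _ hU⟩
    · exact ⟨_, .inr ⟨r i, (hr i hi).1, (hr i hi).2.2 h, rfl⟩, Set.inter_subset_inter_right _ hV⟩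

/-- Supplies the word length m for which the 2 ^ m words overfill the edges, with a the number of
pairs of vertices. -/
theorem exists_mul_lt_two_pow (a l : ℕ) : ∃ m, 0 < m ∧ a * (m * l + 1) < 2 ^ m := by
  have h := tendsto_pow_const_div_const_pow_of_one_lt 1 (one_lt_two : (1 : ℝ) < 2)
  have h0 := h.const_mul ((a : ℝ) * (l + 1))
  rw [mul_zero] at h0
  have h' := h0.eventually (gt_mem_nhds one_pos)
  obtain ⟨m, hm, hm1⟩ := (h'.and (eventually_ge_atTop 1)).exists
  refine ⟨m, hm1, ?_⟩
  rw [pow_one, mul_div_assoc', div_lt_one (by positivity)] at hm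
  have h1 : a * (l + 1) * m < 2 ^ m := by exact_mod_cast hm
  refine lt_of_le_of_lt ?_ h1
  rw [mul_assoc]
  refine Nat.mul_le_mul_left a ?_
  nlinarith

/-! ### Construction of zigzags and of Z-pairs. -/

section Main

variable {X : Type*} [MetricSpace X]

theorem exists_uniform_iterate [CompactSpace X] {f : X → X} (hf : Continuous f) {m : ℕ} (j : Fin m → ℕ) {ε : ℝ}
    (hε : 0 < ε) : ∃ η > 0, ∀ x y, dist x y < η → ∀ i, dist (f^[j i] x) (f^[j i] y) < ε := by
  have h : ∀ i, ∀ᶠ q : X × X in uniformity X, dist (f^[j i] q.1) (f^[j i] q.2) < ε := fun i =>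
    (CompactSpace.uniformContinuous_of_continuous (hf.iterate (j i)))
      (Metric.dist_mem_uniformity hε)
  obtain ⟨η, hη, h⟩ := Metric.mem_uniformity_dist.1 (eventually_all.2 h)
  exact ⟨η, hη, fun x y hxy => h hxy⟩

variable {V : Type*} [Fintype V] {Γ : SimpleGraph V}

theorem IsFine.comp_iterate_symm {N : ℕ} {g : X → realization Γ} {η ε : ℝ} (hg : IsFine N g η)
    (h : X ≃ₜ X) (k : ℕ) (hη : ∀ x y, dist x y < η → dist (h^[k] x) (h^[k] y) < ε) :
    IsFine N (g ∘ h.symm^[k]) ε := by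
  intro x y hxy
  have hinv : Function.LeftInverse h^[k] h.symm^[k] :=
    Function.LeftInverse.iterate h.apply_symm_apply k
  have := hη _ _ (hg (h.symm^[k] x) (h.symm^[k] y) hxy)
  rwa [hinv, hinv] at this

/-- Among more than `c` times as many lattice points as there are pairs of vertices, more than `c` lie
on the same edge. -/
theorem exists_edge_of_card {W : Type*} [Fintype W] {N c : ℕ} {κ : W → V → ℕ}
    (hκ : ∀ σ, IsLatticePoint Γ N (κ σ)) (hinj : Function.Injective κ) (hc : 1 ≤ c)
    (hcard : Fintype.card V ^ 2 * c < Fintype.card W) :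
    ∃ u v, Γ.Adj u v ∧ ∃ F : Finset W, c < F.card ∧
      (∀ σ ∈ F, κ σ u ≤ N ∧ κ σ = segPoint u v (κ σ u) (N - κ σ u)) := by
  classical
  choose u v huv hsupp using fun σ => (hκ σ).2
  obtain ⟨⟨a, b⟩, -, hF⟩ := Finset.exists_lt_card_fiber_of_mul_lt_card_of_maps_to
    (s := (Finset.univ : Finset W)) (t := (Finset.univ : Finset (V × V)))
    (f := fun σ => (u σ, v σ)) (n := c) (by simp)
    (by rw [Finset.card_univ, Finset.card_univ, Fintype.card_prod, ← sq]; exact hcard)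
  set F := Finset.univ.filter fun σ => (u σ, v σ) = (a, b)
  have hseg : ∀ σ ∈ F, κ σ a ≤ N ∧ κ σ = segPoint a b (κ σ a) (N - κ σ a) := by
    intro σ hσ
    have e := (Finset.mem_filter.1 hσ).2
    simp only [Prod.mk.injEq] at e
    refine eq_segPoint_of_sum (hκ σ).1 ?_
    rw [← e.1, ← e.2]
    exact hsupp σ
  obtain ⟨σ, hσ, τ, hτ, hne⟩ := Finset.one_lt_card.1 (lt_of_le_of_lt hc hF)
  -- A degenerate edge carries only one lattice point, but the fibre contains at least two.
  have hab : a ≠ b := by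
    rintro rfl
    refine hne (hinj ?_)
    have h : ∀ σ ∈ F, κ σ a = N := by
      intro σ hσ
      have h1 := congrFun (hseg σ hσ).2 a
      rw [segPoint_self] at h1
      have := (hseg σ hσ).1
      omega
    rw [(hseg σ hσ).2, (hseg τ hτ).2, h σ hσ, h τ hτ]
  refine ⟨a, b, ?_, F, hF, hseg⟩
  have e := (Finset.mem_filter.1 hσ).2
  simp only [Prod.mk.injEq] at e
  rcases huv σ with h | h
  · exact absurd (e.1.symm.trans (h.trans e.2)) hab
  · rwa [e.1, e.2] at h

variable [CompactSpace X]

/-- The families `A` to which the construction of zigzags applies. -/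
def IsDisjointPosIndep (h : X ≃ₜ X) (A : Bool → Set X) : Prop :=
  (∀ b, IsClosed (A b)) ∧ Disjoint (A false) (A true) ∧ HasPosIndep h A

theorem IsDisjointPosIndep.exists_separation {h : X ≃ₜ X} {A : Bool → Set X}
    (hA : IsDisjointPosIndep h A) :
    ∃ ρ > 0, ∀ b c, b ≠ c → ∀ x ∈ A b, ∀ y ∈ A c, ρ ≤ dist x y := by
  obtain ⟨r, hr, hlt⟩ := Metric.exists_pos_forall_lt_edist (hA.1 false).isCompact (hA.1 true) hA.2.1
  have key : ∀ x ∈ A false, ∀ y ∈ A true, (r : ℝ) ≤ dist x y := by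
    intro x hx y hy
    have := (hlt x hx y hy).le
    rw [edist_nndist, ENNReal.coe_le_coe] at this
    exact_mod_cast this
  refine ⟨r, by exact_mod_cast hr, fun b c hbc x hx y hy => ?_⟩
  cases b <;> cases c
  · exact absurd rfl hbc
  · exact key x hx y hy
  · rw [dist_comm]
    exact key y hy x hx
  · exact absurd rfl hbc

theorem exists_zigzag [Nonempty X] {G : Type*} [TopologicalSpace G] (e : G ≃ₜ realization Γ)
    (hX : IsLike X G) (h : X ≃ₜ X) {A : Bool → Set X} (hA : IsDisjointPosIndep h A) {ε : ℝ}
    (hε : 0 < ε) {l : ℕ} (hl : Odd l) :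
    ∃ B : Bool → Set X, IsDisjointPosIndep h B ∧ (∀ b, B b ⊆ A b) ∧
      ∃ 𝒢 : Finset (Set X), IsEpsCover ε 𝒢 ∧ NerveIs G 𝒢 ∧
        ∃ (n : ℕ) (C : ℕ → Set X), IsFreeChainIn 𝒢 n C ∧ B false ⊆ C 1 ∧ B true ⊆ C n ∧
          IsZigzag h l n C (A false) (A true) := by
  classical
  obtain ⟨ρ, hρ, hsep⟩ := hA.exists_separation
  obtain ⟨m, hm, hml⟩ := exists_mul_lt_two_pow (Fintype.card V ^ 2) l
  obtain ⟨j, hj⟩ := hA.2.2.exists_words hm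
  -- ε / 2 controls the mesh of the final cover, and ρ keeps the iterates of one cell from meeting
  -- both A false and A true.
  set δ := min (ε / 2) ρ
  have hδ : 0 < δ := lt_min (by positivity) hρ
  have hδε : δ < ε := (min_le_left _ _).trans_lt (by linarith)
  obtain ⟨η, hη, hunif⟩ := exists_uniform_iterate h.continuous j hδ
  obtain ⟨N, hN, g, hg, hsurj, hfine⟩ := exists_isFine hX e hη
  have hcell : ∀ x, ∃ c : latticePoints Γ N, x ∈ g ⁻¹' latticeCell Γ N c := fun x => by
    obtain ⟨a, ha, hx⟩ := exists_mem_latticeCell (N := N) (g x)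
    exact ⟨⟨a, mem_latticePoints.2 ha⟩, hx⟩
  have : Nonempty (latticePoints Γ N) := ⟨(hcell (Classical.arbitrary X)).choose⟩
  obtain ⟨κ, hκ⟩ := hj.exists_refine _ hcell
  have hinj : Function.Injective fun σ => (κ σ : V → ℕ) := by
    intro σ τ hστ
    by_contra hne
    obtain ⟨i, hi⟩ := Function.ne_iff.1 hne
    obtain ⟨x, hx, hxc⟩ := hκ.nonempty σ
    obtain ⟨y, hy, hyc⟩ := hκ.nonempty τ
    simp only at hστ
    rw [← hστ] at hyc
    have h1 := hunif x y (hfine.dist_lt (latticeCell_subset_latticeStar _ hxc)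
      (latticeCell_subset_latticeStar _ hyc)) i
    have h2 := hsep _ _ hi _ (hx i) _ (hy i)
    exact absurd (h1.trans_le (min_le_right _ _)) (not_lt.2 h2)
  obtain ⟨u, v, huv, F, hF, hseg⟩ := exists_edge_of_card (c := m * l + 1)
    (fun σ => mem_latticePoints.1 (κ σ).2) hinj (by omega) (by simpa using hml)
  let pos : (Fin m → Bool) → ℕ := fun σ => (κ σ : V → ℕ) u
  have hpos : Set.InjOn pos F := by
    intro σ hσ τ hτ hst
    refine hinj ?_
    simp only [pos] at hst
    simp only
    rw [(hseg σ hσ).2, (hseg τ hτ).2, hst]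
  -- Reads off, from an occupied position on the edge, the word whose cell sits there.
  let w : ℕ → Fin m → Bool := Function.invFunOn pos F
  have hw : ∀ t ∈ F.image pos, w t ∈ F ∧ pos (w t) = t := by
    intro t ht
    obtain ⟨σ, hσ, rfl⟩ := Finset.mem_image.1 ht
    exact ⟨Function.invFunOn_mem ⟨σ, hσ, rfl⟩, Function.invFunOn_eq ⟨σ, hσ, rfl⟩⟩
  obtain ⟨i, p, hp, hpw⟩ := exists_alternating_coordinate (l := l) (F.image pos) w
    (fun s hs t ht hst => by rw [← (hw s hs).2, ← (hw t ht).2, hst])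
    (by rwa [Finset.card_image_of_injOn hpos])
  set g' : X → realization Γ := g ∘ h.symm^[j i] with hg'def
  have hg' : Continuous g' := hg.comp (h.symm.continuous.iterate _)
  have hsurj' : Function.Surjective g' := hsurj.comp (h.symm.surjective.iterate _)
  have hfine' : IsFine N g' δ := hfine.comp_iterate_symm h (j i) fun x y hxy => hunif x y hxy i
  -- The refined word sets moved forward by the time of the alternating coordinate: Q σ lies in A (σ
  -- i) and, for σ in F, in the star under g' at the position of σ. All the Q σ are jointly
  -- independent.
  let Q : (Fin m → Bool) → Set X := fun σ =>
    h^[j i] '' ({x | ∀ i, h^[j i] x ∈ A (σ i)} ∩ g ⁻¹' latticeCell Γ N (κ σ))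
  have hQ : HasPosIndep h Q := hκ.map id (j i) fun σ x hx => ⟨x, hx, rfl⟩
  have hQclosed : ∀ σ, IsClosed (Q σ) := by
    intro σ
    refine (IsCompact.image (IsClosed.isCompact ?_) (h.continuous.iterate _)).isClosed
    refine IsClosed.inter ?_ ((isClosed_latticeCell _).preimage hg)
    rw [Set.ofPred_forall]
    exact isClosed_iInter fun i => (hA.1 (σ i)).preimage (h.continuous.iterate _)
  have hQA : ∀ σ, Q σ ⊆ A (σ i) := by
    rintro σ _ ⟨x, ⟨hx, -⟩, rfl⟩
    exact hx i
  have hQC : ∀ σ ∈ F, Q σ ⊆ g' ⁻¹' latticeStar Γ N (segPoint u v (pos σ) (N - pos σ)) := by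
    rintro σ hσ _ ⟨x, ⟨-, hx⟩, rfl⟩
    have : g' (h^[j i] x) = g x := by
      simp only [hg'def, Function.comp_apply]
      rw [Function.LeftInverse.iterate h.symm_apply_apply]
    rw [Set.mem_preimage, this, ← (hseg σ hσ).2]
    exact latticeCell_subset_latticeStar _ hx
  have h1 : 1 ∈ Set.Icc 1 (l + 1) := by simp
  have hl1 : l + 1 ∈ Set.Icc 1 (l + 1) := by simp
  have hple : ∀ k ∈ Set.Icc 1 (l + 1), p 1 ≤ p k ∧ p k ≤ p (l + 1) := fun k hk =>
    ⟨hp.monotoneOn h1 hk hk.1, hp.monotoneOn hk hl1 hk.2⟩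
  have hpN : p (l + 1) ≤ N := by
    have := hw _ (hpw _ hl1).1
    rw [← this.2]
    exact (hseg _ this.1).1
  set C := edgeLink N g' u v (p 1) with hC
  have hlink : ∀ k ∈ Set.Icc 1 (l + 1), Q (w (p k)) ⊆ C (p k - p 1 + 1) := by
    intro k hk
    have h2 := hw _ (hpw _ hk).1
    have := hQC _ h2.1
    rw [h2.2] at this
    rwa [hC, edgeLink, show p 1 + (p k - p 1 + 1) - 1 = p k by have := (hple k hk).1; omega]
  have hside : ∀ k ∈ Set.Icc 1 (l + 1), Q (w (p k)) ⊆ A (decide (Even k)) := by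
    intro k hk
    rw [← (hpw k hk).2]
    exact hQA _
  -- The sets at the two ends of the zigzag; l + 1 is even, so the last one lies in A true.
  let B : Bool → Set X := fun b => Q (w (p (if b then l + 1 else 1)))
  have hBA : ∀ b, B b ⊆ A b := by
    intro b
    cases b
    · simpa [B] using hside 1 h1
    · simpa [B, hl.add_one] using hside (l + 1) hl1
  refine ⟨B, ⟨fun b => hQclosed _, hA.2.1.mono (hBA _) (hBA _),
    hQ.map (fun b => w (p (if b then l + 1 else 1))) 0 fun b x hx => hx⟩, hBA, starCover N g',
    isEpsCover_starCover hg' hδ hδε hfine', ?_, p (l + 1) - p 1 + 1, C,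
    isFreeChainIn_edgeLink hN hg' hsurj' huv (by omega)
      (by have := (hple _ hl1).1; omega), ?_, hlink _ hl1, ?_⟩
  · obtain ⟨φ⟩ := nonempty_homeomorph_realization_nerve hN hsurj'
    exact ⟨φ.trans e.symm⟩
  · simpa [B] using hlink 1 h1
  · have hfalse : ∀ k ∈ Set.Icc 1 (l + 1), Odd k →
        Q (w (p k)) ⊆ C (p k - p 1 + 1) ∩ A false := fun k hk hodd => by
      have := hside k hk
      rw [decide_eq_false (Nat.not_even_iff_odd.2 hodd)] at this
      exact Set.subset_inter (hlink k hk) this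
    have htrue : ∀ k ∈ Set.Icc 1 (l + 1), Even k →
        Q (w (p k)) ⊆ C (p k - p 1 + 1) ∩ A true := fun k hk heven => by
      have := hside k hk
      rw [decide_eq_true heven] at this
      exact Set.subset_inter (hlink k hk) this
    refine ⟨fun k => p k - p 1 + 1, by simp, rfl, fun a ha b hb hab => ?_,
      fun k hk hodd => (hQ.nonempty _).mono (hfalse k hk hodd),
      fun k hk heven => (hQ.nonempty _).mono (htrue k hk heven), hQ.hasISPD ?_⟩
    · have := hp ha hb hab
      have := (hple a ha).1
      simp only
      omega
    · rintro S (⟨k, hk, hodd, rfl⟩ | ⟨k, hk, heven, rfl⟩)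
      · exact ⟨_, hfalse k hk hodd⟩
      · exact ⟨_, htrue k hk heven⟩

/-- Iterate `exists_zigzag`, at stage k with mesh 1 / (k + 1) and 2 * k + 1 turns. Each new end set
lies in one link, so the nested compact sets shrink to single points. -/
theorem exists_isZPair [Nonempty X] {G : Type*} [TopologicalSpace G] (e : G ≃ₜ realization Γ)
    (hX : IsLike X G) (h : X ≃ₜ X) {A : Bool → Set X} (hA : IsDisjointPosIndep h A) :
    ∃ x ∈ A false, ∃ y ∈ A true, IsZPair G h x y := by
  have step : ∀ (A : {A : Bool → Set X // IsDisjointPosIndep h A}) (k : ℕ),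
      ∃ B : {A : Bool → Set X // IsDisjointPosIndep h A}, (∀ b, B.1 b ⊆ A.1 b) ∧
      ∃ 𝒢 : Finset (Set X), IsEpsCover (1 / ((k : ℝ) + 1)) 𝒢 ∧ NerveIs G 𝒢 ∧
        ∃ (n : ℕ) (C : ℕ → Set X), IsFreeChainIn 𝒢 n C ∧ B.1 false ⊆ C 1 ∧ B.1 true ⊆ C n ∧
          IsZigzag h (2 * k + 1) n C (A.1 false) (A.1 true) := by
    intro A k
    obtain ⟨B, hB, hBA, h𝒢⟩ := exists_zigzag e hX h A.2 (ε := 1 / ((k : ℝ) + 1)) (by positivity)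
      (odd_two_mul_add_one k)
    exact ⟨⟨B, hB⟩, hBA, h𝒢⟩
  choose F hFA hF using step
  let D : ℕ → {A : Bool → Set X // IsDisjointPosIndep h A} := fun k =>
    Nat.rec ⟨A, hA⟩ (fun k B => F B k) k
  have hD : ∀ k, D (k + 1) = F (D k) k := fun k => rfl
  have hsub : ∀ k b, (D (k + 1)).1 b ⊆ (D k).1 b := fun k b => hFA (D k) k b
  have hpt : ∀ b, ∃ x, ∀ k, x ∈ (D k).1 b := by
    intro b
    obtain ⟨x, hx⟩ := IsCompact.nonempty_iInter_of_sequence_nonempty_isCompact_isClosed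
      (fun k => (D k).1 b) (fun k => hsub k b) (fun k => (D k).2.2.2.nonempty b)
      ((D 0).2.1 b).isCompact fun k => (D k).2.1 b
    exact ⟨x, Set.mem_iInter.1 hx⟩
  obtain ⟨x, hx⟩ := hpt false
  obtain ⟨y, hy⟩ := hpt true
  have hsmall : ∀ k b, ∀ z ∈ (D (k + 1)).1 b, ∀ z' ∈ (D (k + 1)).1 b,
      dist z z' < 1 / ((k : ℝ) + 1) := by
    intro k b
    obtain ⟨𝒢, h𝒢, -, n, C, hC, h0, h1, -⟩ := hF (D k) k
    rw [← hD] at h0 h1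
    obtain ⟨S, hS, hbS⟩ : ∃ S ∈ 𝒢, (D (k + 1)).1 b ⊆ S := by
      cases b
      · exact ⟨_, hC.1.2.1 1 ⟨le_rfl, hC.1.1⟩, h0⟩
      · exact ⟨_, hC.1.2.1 n ⟨hC.1.1, le_rfl⟩, h1⟩
    exact fun z hz z' hz' => (Metric.dist_le_diam_of_mem Metric.isBounded_of_compactSpace
      (hbS hz) (hbS hz')).trans_lt (h𝒢.1 S hS).2
  refine ⟨x, hx 0, y, hy 0, fun U W hU hW hxU hyW ε hε l hl => ?_⟩
  obtain ⟨r, hr, hrU⟩ := Metric.isOpen_iff.1 hU x hxU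
  obtain ⟨s, hs, hsW⟩ := Metric.isOpen_iff.1 hW y hyW
  obtain ⟨k₀, hk₀⟩ := exists_nat_one_div_lt (lt_min hε (lt_min hr hs))
  set k := max k₀ l
  have hk : 1 / ((k : ℝ) + 1) < min ε (min r s) := by
    refine lt_of_le_of_lt ?_ hk₀
    have : (k₀ : ℝ) ≤ k := by exact_mod_cast le_max_left _ _
    gcongr
  have hk' : 1 / (((k + 1 : ℕ) : ℝ) + 1) ≤ ε := by
    refine le_trans ?_ (hk.le.trans (min_le_left _ _))
    push_cast
    gcongr
    linarith
  -- Stage k + 1 is used because its input sets D (k + 1) already lie in U and W, while x and y lie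
  -- in its output D (k + 2), hence in the end links.
  obtain ⟨𝒢, h𝒢, hN, n, C, hC, h0, h1, hz⟩ := hF (D (k + 1)) (k + 1)
  refine ⟨𝒢, ⟨fun S hS => ⟨(h𝒢.1 S hS).1, (h𝒢.1 S hS).2.trans_le hk'⟩, h𝒢.2⟩, hN, n, C, hC,
    h0 (hx (k + 2)), h1 (hy (k + 2)), hz.mono ?_ hl (odd_two_mul_add_one _) ?_ ?_⟩
  · have : l ≤ k := le_max_right _ _
    omega
  · exact fun z hz => hrU <| (hsmall k _ z hz x (hx (k + 1))).trans
      (hk.trans_le ((min_le_right _ _).trans (min_le_left _ _)))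
  · exact fun z hz => hsW <| (hsmall k _ z hz y (hy (k + 1))).trans
      (hk.trans_le ((min_le_right _ _).trans (min_le_right _ _)))

end Main

end ZigzagPair

/-! ### The main theorem. -/

theorem mainTheorem6 {X : Type*} [MetricSpace X] [CompactSpace X] [ConnectedSpace X]
    {G : Type*} [TopologicalSpace G] (hG : ZigzagPair.IsFiniteGraph G)
    (hX : ZigzagPair.IsLike X G) (h : X ≃ₜ X) :
    (∀ A₀ A₁ : Set X, IsClosed A₀ → IsClosed A₁ → Disjoint A₀ A₁ →
      ZigzagPair.HasISPD h {A₀, A₁} →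
        ∃ x ∈ A₀, ∃ y ∈ A₁, ZigzagPair.IsZPair G h x y) ∧
    (∀ x y : X, x ≠ y → ZigzagPair.IsIEPair h x y →
      ∀ ε : ℝ, 0 < ε → ∃ x' y' : X, dist x' x < ε ∧ dist y' y < ε ∧
        ZigzagPair.IsZPair G h x' y') := by
  obtain ⟨m, Γ, ⟨e⟩⟩ := hG
  have part1 : ∀ A₀ A₁ : Set X, IsClosed A₀ → IsClosed A₁ → Disjoint A₀ A₁ →
      ZigzagPair.HasISPD h {A₀, A₁} → ∃ x ∈ A₀, ∃ y ∈ A₁, ZigzagPair.IsZPair G h x y := by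
    intro A₀ A₁ h₀ h₁ hdisj hispd
    exact ZigzagPair.exists_isZPair e hX h (A := fun b => cond b A₁ A₀)
      ⟨fun b => by cases b <;> assumption, hdisj,
        hispd.hasPosIndep fun b => by cases b <;> simp⟩
  refine ⟨part1, fun x y hxy hIE ε hε => ?_⟩
  have hd : 0 < dist x y := dist_pos.2 hxy
  -- ε / 2 makes closed-ball points strictly ε-close, and a third of the distance keeps the two
  -- closed balls disjoint.
  set r := min (ε / 2) (dist x y / 3)
  have hr : 0 < r := lt_min (by positivity) (by positivity)
  have hrε : r < ε := (min_le_left _ _).trans_lt (by linarith)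
  obtain ⟨x', hx', y', hy', hZ⟩ := part1 (Metric.closedBall x r) (Metric.closedBall y r)
    Metric.isClosed_closedBall Metric.isClosed_closedBall
    (Metric.closedBall_disjoint_closedBall (by
      have : r ≤ dist x y / 3 := min_le_right _ _
      linarith))
    ((hIE _ _ Metric.isOpen_ball Metric.isOpen_ball (Metric.mem_ball_self hr)
      (Metric.mem_ball_self hr)).mono (by
        rintro S (rfl | rfl)
        · exact ⟨_, .inl rfl, Metric.ball_subset_closedBall⟩
        · exact ⟨_, .inr rfl, Metric.ball_subset_closedBall⟩))
  exact ⟨x', y', (Metric.mem_closedBall.1 hx').trans_lt hrε,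
    (Metric.mem_closedBall.1 hy').trans_lt hrε, hZ⟩
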